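/- Let $\Sigma$ be a finite alphabet with at least two symbols. For every $\varepsilon>0$ there is an infinite sequence $S\in\Sigma^\infty$ such that $$R_{\mathrm{invPD}}(S)\le \tfrac12\qquad\text{and}\qquad \rho_{\mathrm{plogon}}(S)\ge 1-\varepsilon .$$ Here, for $T:\Sigma^*\to\Sigma^*$, $R_T(S)=\limsup_{n\to\infty}|T(S[1..n])|/n$ and $\rho_T(S)=\liminf_{n\to\infty}|T(S[1..n])|/n$. A pushdown transducer is a deterministic machine with finitely many states, a finite stack alphabet, a start stack symbol $z_0$ that is never removed from the bottom of the stack, a partial transition function $\delta:Q\times(\Sigma\cup\{\lambda\})\times\Gamma\to Q\times\Gamma^*$, an output function $\nu$ that gives a word for each input symbol read (depending on the state, the symbol and the top of the stack), and a bound $c\in\mathbb N$. A $\lambda$-rule reads no input, outputs nothing and pops the top symbol of the stack; for given state and top symbol either no $\lambda$-rule or no reading rule is defined; $\lambda$-rules are applied as long as possible, and at most $c$ of them between consecutive input symbols. $R_{\mathrm{invPD}}(S)$ is the infimum of $R_C(S)$ over all invertible pushdown compressors $C$, that is, pushdown transducers $C$ from $\Sigma$ to $\Sigma$, defined on all of $\Sigma^*$,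 for which $w\mapsto(C(w),\text{final state of }C\text{ on }w)$ is one-to-one, and for which there is a pushdown transducer $D$ that, for every $w\in\Sigma^*$, on input $C(w)$ followed by the final state of $C$ on $w$, outputs $w$. $\rho_{\mathrm{plogon}}(S)$ is the infimum of $\rho_C(S)$ over all one-to-one functions $C:\Sigma^*\to\Sigma^*$ computed by a deterministic Turing machine that reads its input once from left to right, is given the input length $n$ in binary on a separate read-only tape, writes its output from left to right on a write-only tape, and uses work space polylogarithmic in $n$. -/

import Mathlib

open Filter

/-! ### Compression ratios -/

/-- The prefix of length `n` of the sequence `S`. -/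
def seqPrefix {A : Type} (S : ℕ → A) (n : ℕ) : List A := (List.range n).map S

/-- `ρ_T(S) = liminf |T(S[1..n])| / n`, as an extended real number. -/
noncomputable def lowerRatio {A : Type} (T : List A → List A) (S : ℕ → A) : EReal :=
  liminf (fun n : ℕ => ((((T (seqPrefix S n)).length : ℝ) / (n : ℝ) : ℝ) : EReal)) atTop

/-- `R_T(S) = limsup |T(S[1..n])| / n`, as an extended real number. -/
noncomputable def upperRatio {A : Type} (T : List A → List A) (S : ℕ → A) : EReal :=
  limsup (fun n : ℕ => ((((T (seqPrefix S n)).length : ℝ) / (n : ℝ) : ℝ) : EReal)) atTop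

/-! ### Pushdown transducers -/

/-- A bounded deterministic pushdown transducer with input alphabet `I` and output alphabet `O`.
Stacks are lists of stack symbols with the top symbol first; `none` as the second argument of `δ`
is the empty word `λ`, and `none` as a value of `δ` means undefined. -/
structure PushdownTransducer (I O : Type) where
  /-- states -/
  Q : Type
  /-- stack symbols -/
  Γ : Type
  finite_Q : Finite Q
  finite_Γ : Finite Γ
  /-- transition function; the top symbol is replaced by a word -/
  δ : Q → Option I → Γ → Option (Q × List Γ)
  /-- output function -/
  ν : Q → I → Γ → List O
  /-- initial state -/
  q₀ : Q
  /-- start stack symbol -/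
  z₀ : Γ
  /-- bound on the number of `λ`-rules between two consecutive input symbols -/
  c : ℕ
  /-- the start symbol is never removed from the bottom of the stack -/
  bottom : ∀ q b q' s, δ q b z₀ = some (q', s) → ∃ v, s = v ++ [z₀]
  /-- a `λ`-rule pops the top symbol of the stack -/
  lambda_pop : ∀ q a q' s, δ q none a = some (q', s) → s = []
  /-- determinism -/
  determ : ∀ q a, δ q none a = none ∨ ∀ b, δ q (some b) a = none

namespace PushdownTransducer

variable {I O : Type}

/-- Apply `λ`-rules as long as one is applicable; undefined if more than `n` would be applied. -/
def lambdaClosure (M : PushdownTransducer I O) (n : ℕ) (q : M.Q) (stack : List M.Γ) :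
    Option (M.Q × List M.Γ) :=
  match stack with
  | [] => some (q, [])
  | a :: s =>
    match M.δ q none a with
    | none => some (q, a :: s)
    | some (q', v) =>
      match n with
      | 0 => none
      | n + 1 => lambdaClosure M n q' (v ++ s)

/-- Read one input symbol and then apply the applicable `λ`-rules. The result consists of the new
state, the new stack and the word that is output. -/
def readSymbol (M : PushdownTransducer I O) (q : M.Q) (stack : List M.Γ) (b : I) :
    Option (M.Q × List M.Γ × List O) :=
  match stack with
  | [] => none
  | a :: s =>
    match M.δ q (some b) a with
    | none => none
    | some (q', v) =>
      match M.lambdaClosure M.c q' (v ++ s) with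
      | none => none
      | some (q'', s'') => some (q'', s'', M.ν q b a)

/-- Read an input word; the result is the output word and the final state. -/
def runFrom (M : PushdownTransducer I O) (q : M.Q) (stack : List M.Γ) :
    List I → Option (List O × M.Q)
  | [] => some ([], q)
  | b :: w =>
    match M.readSymbol q stack b with
    | none => none
    | some (q', s', u) => (M.runFrom q' s' w).map fun r => (u ++ r.1, r.2)

/-- `w ↦ (M(w), δ_Q(w))`: output and final state on input `w`. -/
def transduce (M : PushdownTransducer I O) (w : List I) : Option (List O × M.Q) :=
  match M.lambdaClosure M.c M.q₀ [M.z₀] with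
  | none => none
  | some (q, s) => M.runFrom q s w

/-- Information-lossless pushdown compressor: the map `w ↦ (M(w), δ_Q(w))` is total and
one-to-one. -/
def IsILPDC {A : Type} (M : PushdownTransducer A A) : Prop :=
  (∀ w, (M.transduce w).isSome) ∧ Function.Injective M.transduce

end PushdownTransducer

/-- `T` is the function computed by the compressor `C` of an invertible pushdown compressor
`(C, D)`: the pushdown transducer `D`, reading `C(w)` followed by the final state of `C` on `w`,
outputs `w`. -/
def IsInvPD {A : Type} (T : List A → List A) : Prop :=
  ∃ (C : PushdownTransducer A A) (D : PushdownTransducer (A ⊕ C.Q) A),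
    C.IsILPDC ∧
    ∀ w : List A, ∃ (q : C.Q) (q' : D.Q),
      C.transduce w = some (T w, q) ∧
      D.transduce ((T w).map Sum.inl ++ [Sum.inr q]) = some (w, q')

/-- Worst-case invertible pushdown compression ratio of `S`. -/
noncomputable def RInvPD {A : Type} (S : ℕ → A) : EReal :=
  ⨅ (T : List A → List A) (_ : IsInvPD T), upperRatio T S

/-! ### Online Turing transducers with polylogarithmic space -/

/-- Head movements. -/
inductive HeadMove
  | left
  | stay
  | right

/-- New position of a head on a one-way infinite tape; at cell `0` a left move has no effect. -/
def HeadMove.apply : HeadMove → ℕ → ℕ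
  | .left, i => i - 1
  | .stay, i => i
  | .right, i => i + 1

/-- What a machine does in one step. -/
structure OnlineAction (A : Type) (numStates numSymbols : ℕ) where
  /-- next state -/
  next : Fin numStates
  /-- whether the input head advances by one cell -/
  advance : Bool
  /-- movement of the head on the length tape -/
  lenMove : HeadMove
  /-- symbol written on the work tape -/
  write : Fin numSymbols
  /-- movement of the head on the work tape -/
  workMove : HeadMove
  /-- word appended to the output tape -/
  emit : List A

/-- A deterministic Turing transducer with a one-way read-only input tape, a two-way read-only tape
that holds the length of the input in binary, a work tape and a write-only output tape. The input
symbol and the bit under the heads are `none` when the end of the respective tape is reached; the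
machine halts when no action is defined. -/
structure OnlineTM (A : Type) where
  numStates : ℕ
  numSymbols : ℕ
  start : Fin numStates
  blank : Fin numSymbols
  act : Fin numStates → Option A → Option Bool → Fin numSymbols →
    Option (OnlineAction A numStates numSymbols)

namespace OnlineTM

variable {A : Type}

/-- Configurations. -/
structure Config (M : OnlineTM A) where
  state : Fin M.numStates
  inPos : ℕ
  lenPos : ℕ
  tape : ℕ → Fin M.numSymbols
  head : ℕ
  out : List A

/-- Initial configuration. -/
def init (M : OnlineTM A) : M.Config where
  state := M.start
  inPos := 0
  lenPos := 0
  tape := fun _ => M.blank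
  head := 0
  out := []

/-- One step on input `w`; `none` means that the machine has halted. The heads on the input tape
and on the length tape do not move beyond the first cell after the content of their tape. -/
def step (M : OnlineTM A) (w : List A) (s : M.Config) : Option M.Config :=
  (M.act s.state w[s.inPos]? (Nat.bits w.length)[s.lenPos]? (s.tape s.head)).map fun a =>
    { state := a.next
      inPos := if a.advance then min (s.inPos + 1) w.length else s.inPos
      lenPos := min (a.lenMove.apply s.lenPos) (Nat.bits w.length).length
      tape := Function.update s.tape s.head a.write
      head := a.workMove.apply s.head
      out := s.out ++ a.emit }

/-- On every input `w` the machine halts with output `T w`. -/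
def Computes (M : OnlineTM A) (T : List A → List A) : Prop :=
  ∀ w, ∃ s, StateTransition.Reaches (M.step w) M.init s ∧ M.step w s = none ∧ s.out = T w

/-- The number of work tape cells that are used on an input of length `n` is at most polylogarithmic
in `n`. The summand `2` leaves room for a cell, and for constant factors, where `log n` is small. -/
def PolylogSpace (M : OnlineTM A) : Prop :=
  ∃ e : ℕ, ∀ w s, StateTransition.Reaches (M.step w) M.init s →
    s.head < (Nat.log 2 w.length + 2) ^ e

end OnlineTM

/-- `T` is computed by an information lossless plogon compressor. -/
def IsILplog {A : Type} (T : List A → List A) : Prop :=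
  (∃ M : OnlineTM A, M.Computes T ∧ M.PolylogSpace) ∧ Function.Injective T

/-- Best-case plogon compression ratio of `S`. -/
noncomputable def rhoPlogon {A : Type} (S : ℕ → A) : EReal :=
  ⨅ (T : List A → List A) (_ : IsILplog T), lowerRatio T S

/-! The sequence is a concatenation of blocks `x j`, `a₁`, reversal of `x j`, where `x j` consists
of `scale j` frames, each a fixed symbol `a₀ ≠ a₁` followed by a constant number of free symbols.
The block length is of order `j`, so a prefix of `J` blocks has length of order `J²` and an
incomplete last block is negligible.

Upper bound: a pushdown compressor cuts the first half into long frames of length `L` and pushes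
their reversals. It recognises the centre because `a₁` never begins a frame, and afterwards it emits
a single `a₁` for each frame that equals the top of the stack. The second half thus shrinks by the
factor `L`. Since `scale j` is a power of two, one `L`, a constant times `2 ^ ρ`, divides the
lengths of all late halves; letting `ρ` grow brings the infimum down to one half
(`isInvPD_palOutput`, `length_palOutput`, `eventually_ratio_palOutput_le`).

Lower bound: a one-way machine with polylogarithmic space cannot remember `x j` when it reads the
reversal. By injectivity, the piece of input read between two configurations is determined by these
configurations and the output in between (`Segment.eq`), so few words can be read with short output
(`card_filter_shortOutput`). There are countably many machines, so halves can be chosen on which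
every admissible machine eventually fails, in both directions (`exists_hard_blocks`). Summing over
blocks (`le_length_of_blocks`) loses about two symbols per frame, which is a small fraction when
frames are long. -/

namespace PushdownTransducer

/-! ### Pushdown transducers without `λ`-rules. -/

section RealTime

variable {I O Q Γ : Type}

/-- The pushdown transducer without `λ`-rules whose total transition and output functions are given
by `tr`. -/
@[reducible] def realTime [Finite Q] [Finite Γ] (tr : Q → Γ → I → Q × List Γ × List O) (q₀ : Q) (z₀ : Γ)
    (h : ∀ q b, ∃ v, (tr q z₀ b).2.1 = v ++ [z₀]) : PushdownTransducer I O where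
  Q := Q
  Γ := Γ
  finite_Q := inferInstance
  finite_Γ := inferInstance
  δ q b a := b.map fun b => ((tr q a b).1, (tr q a b).2.1)
  ν q b a := (tr q a b).2.2
  q₀ := q₀
  z₀ := z₀
  c := 0
  bottom := by
    intro q b q' s hs
    cases b with
    | none => simp at hs
    | some b =>
      simp only [Option.map_some, Option.some.injEq, Prod.mk.injEq] at hs
      obtain ⟨v, hv⟩ := h q b
      exact ⟨v, hs.2 ▸ hv⟩
  lambda_pop := by simp
  determ := by simp

/-- Output, final state and final stack of a run of a real-time transducer; the run gets stuck on
the empty stack. -/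
def exec (tr : Q → Γ → I → Q × List Γ × List O) : Q → List Γ → List I → List O × Q × List Γ
  | q, s, [] => ([], q, s)
  | q, [], _ :: _ => ([], q, [])
  | q, a :: s, b :: w =>
    ((tr q a b).2.2 ++ (exec tr (tr q a b).1 ((tr q a b).2.1 ++ s) w).1,
      (exec tr (tr q a b).1 ((tr q a b).2.1 ++ s) w).2)

variable {tr : Q → Γ → I → Q × List Γ × List O}

@[simp] theorem exec_nil (q : Q) (s : List Γ) : exec tr q s [] = ([], q, s) := by
  cases s <;> rfl

theorem exec_cons (q : Q) (a : Γ) (s : List Γ) (b : I) (w : List I) :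
    exec tr q (a :: s) (b :: w) =
      ((tr q a b).2.2 ++ (exec tr (tr q a b).1 ((tr q a b).2.1 ++ s) w).1,
      (exec tr (tr q a b).1 ((tr q a b).2.1 ++ s) w).2) := rfl

theorem exec_empty (q : Q) (w : List I) : exec tr q [] w = ([], q, []) := by
  cases w <;> rfl

theorem exec_append (q : Q) (s : List Γ) (u v : List I) :
    exec tr q s (u ++ v) =
      ((exec tr q s u).1 ++ (exec tr (exec tr q s u).2.1 (exec tr q s u).2.2 v).1,
        (exec tr (exec tr q s u).2.1 (exec tr q s u).2.2 v).2) := by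
  induction u generalizing q s with
  | nil => simp
  | cons b u ih =>
    cases s with
    | nil => simp [exec_empty]
    | cons a s => simp [exec_cons, ih]

theorem exec_append_of_eq {q q' : Q} {s s' : List Γ} {u v : List I} {o : List O}
    (h : exec tr q s u = (o, q', s')) :
    exec tr q s (u ++ v) = (o ++ (exec tr q' s' v).1, (exec tr q' s' v).2) := by
  rw [exec_append, h]

/-- The bottom symbol survives every transition, so the stack is never empty and a run never gets
stuck; this makes the transducers total. -/
theorem exec_bottom {z₀ : Γ} (h : ∀ q b, ∃ v, (tr q z₀ b).2.1 = v ++ [z₀]) (q : Q) (v : List Γ)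
    (w : List I) : ∃ v', (exec tr q (v ++ [z₀]) w).2.2 = v' ++ [z₀] := by
  induction w generalizing q v with
  | nil => exact ⟨v, by simp⟩
  | cons b w ih =>
    cases v with
    | nil =>
      obtain ⟨v', hv'⟩ := h q b
      simpa [exec_cons, hv'] using ih (tr q z₀ b).1 v'
    | cons a v =>
      simpa [exec_cons] using ih (tr q a b).1 ((tr q a b).2.1 ++ v)

theorem lambdaClosure_realTime [Finite Q] [Finite Γ] {q₀ : Q} {z₀ : Γ}
    (h : ∀ q b, ∃ v, (tr q z₀ b).2.1 = v ++ [z₀]) (n : ℕ) (q : Q) (s : List Γ) :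
    (realTime tr q₀ z₀ h).lambdaClosure n q s = some (q, s) := by
  cases s <;> cases n <;> rfl

theorem runFrom_realTime [Finite Q] [Finite Γ] {q₀ : Q} {z₀ : Γ}
    (h : ∀ q b, ∃ v, (tr q z₀ b).2.1 = v ++ [z₀]) (q : Q) (v : List Γ) (w : List I) :
    (realTime tr q₀ z₀ h).runFrom q (v ++ [z₀]) w =
      some ((exec tr q (v ++ [z₀]) w).1, (exec tr q (v ++ [z₀]) w).2.1) := by
  induction w generalizing q v with
  | nil => simp [runFrom]
  | cons b w ih =>
    have key : ∀ a s, (realTime tr q₀ z₀ h).readSymbol q (a :: s) b =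
        some ((tr q a b).1, (tr q a b).2.1 ++ s, (tr q a b).2.2) := by
      intro a s
      simp only [readSymbol, Option.map_some, lambdaClosure_realTime h]
    cases v with
    | nil =>
      obtain ⟨v', hv'⟩ := h q b
      simp only [List.nil_append, runFrom, key, exec_cons, hv', List.append_nil, ih]
      simp
    | cons a v =>
      have := ih (tr q a b).1 ((tr q a b).2.1 ++ v)
      simp only [List.append_assoc] at this
      simp [runFrom, key, exec_cons, this]

theorem transduce_realTime [Finite Q] [Finite Γ] {q₀ : Q} {z₀ : Γ}
    (h : ∀ q b, ∃ v, (tr q z₀ b).2.1 = v ++ [z₀]) (w : List I) :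
    (realTime tr q₀ z₀ h).transduce w =
      some ((exec tr q₀ [z₀] w).1, (exec tr q₀ [z₀] w).2.1) := by
  simp only [transduce, lambdaClosure_realTime h]
  exact runFrom_realTime h q₀ [] w

end RealTime

/-! ### The palindrome compressor and its inverse. -/

section Palindromes

variable {A : Type} {L N : ℕ}

/-- Words of length at most `L`. -/
abbrev Buffer (A : Type) (L : ℕ) : Type := {l : List A // l.length ≤ L}

/-- The first `L` symbols of a word. -/
def Buffer.trunc (L : ℕ) (l : List A) : Buffer A L := ⟨l.take L, by simp⟩

instance [Finite A] : Finite (Buffer A L) := (List.finite_length_le A L).to_subtype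

/-- States of the palindrome compressor: copy a given number of symbols, read and push a frame,
compare a frame with the top of the stack, copy forever. -/
inductive PalState (A : Type) (L N : ℕ)
  | copyFor (i : Fin (N + 1))
  | push (p : Buffer A L)
  | pop (p : Buffer A L)
  | copy

instance [Finite A] : Finite (PalState A L N) := by
  refine Finite.of_injective (β := Fin (N + 1) ⊕ Buffer A L ⊕ Buffer A L ⊕ Unit)
    (fun q => match q with
      | .copyFor i => .inl i
      | .push p => .inr (.inl p)
      | .pop p => .inr (.inr (.inl p))
      | .copy => .inr (.inr (.inr ()))) ?_
  intro q q' h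
  cases q <;> cases q' <;> simp_all

/-- The part of the input that the decompressor has not yet reconstructed. -/
def PalState.pending : PalState A L N → List A
  | .pop p => p.1
  | _ => []

/-- A transition in copying mode with a counter. -/
def copyForStep (i : Fin (N + 1)) (g : Option (Buffer A L)) (b : A) :
    PalState A L N × List (Option (Buffer A L)) × List A :=
  (if i.1 = 0 then .push (.trunc L []) else .copyFor ⟨i.1 - 1, by omega⟩, [g], [b])

open Classical in
/-- A transition in pushing mode: `a₁` at the beginning of a frame announces the reversal; complete
frames are pushed in reversed form. -/
noncomputable def pushStep (a₁ : A) (p : List A) (g : Option (Buffer A L)) (b : A) :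
    PalState A L N × List (Option (Buffer A L)) × List A :=
  if p = [] ∧ b = a₁ then (.pop (.trunc L []), [g], [b])
  else if (p ++ [b]).length < L then (.push (.trunc L (p ++ [b])), [g], [b])
  else (.push (.trunc L []), [some (.trunc L (p ++ [b]).reverse), g], [b])

open Classical in
/-- Transitions of the palindrome compressor. A frame that agrees with the top of the stack is
replaced by the single symbol `a₁`. -/
noncomputable def palCompress (a₀ a₁ : A) :
    PalState A L N → Option (Buffer A L) → A →
      PalState A L N × List (Option (Buffer A L)) × List A
  | .copyFor i, g, b => copyForStep i g b
  | .push p, g, b => pushStep a₁ p.1 g b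
  -- The stack is used up, so `b` begins a new block and is treated as the first symbol of a frame
  -- to be pushed.
  | .pop _, none, b => pushStep a₁ [] none b
  | .pop p, some f, b =>
    if (p.1 ++ [b]).length < L then (.pop (.trunc L (p.1 ++ [b])), [some f], [])
    else if p.1 ++ [b] = f.1 then (.pop (.trunc L []), [], [a₁])
    -- Escape for inputs without the expected shape: `a₀` tells the decompressor that no match
    -- follows, and the buffered symbols are released.
    else (.copy, [some f], a₀ :: (p.1 ++ [b]))
  | .copy, g, b => (.copy, [g], [b])

open Classical in
/-- Transitions of the palindrome decompressor. -/
noncomputable def palDecompress (a₁ : A) :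
    PalState A L N → Option (Buffer A L) → A ⊕ PalState A L N →
      PalState A L N × List (Option (Buffer A L)) × List A
  -- The final state supplies the incomplete frame that the compressor has read without any output.
  | q, g, .inr q' => (q, [g], q'.pending)
  | .copyFor i, g, .inl b => copyForStep i g b
  | .push p, g, .inl b => pushStep a₁ p.1 g b
  | .pop _, none, .inl b => pushStep a₁ [] none b
  | .pop _, some f, .inl b =>
    if b = a₁ then (.pop (.trunc L []), [], f.1) else (.copy, [some f], [])
  | .copy, g, .inl b => (.copy, [g], [b])

theorem exists_pushStep_bottom (a₁ : A) (p : List A) (b : A) :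
    ∃ v, (pushStep a₁ p none b : PalState A L N × List (Option (Buffer A L)) × List A).2.1 =
      v ++ [none] := by
  unfold pushStep
  split_ifs
  · exact ⟨[], rfl⟩
  · exact ⟨[], rfl⟩
  · exact ⟨[_], rfl⟩

theorem exists_palCompress_bottom (a₀ a₁ : A) (q : PalState A L N) (b : A) :
    ∃ v, (palCompress a₀ a₁ q none b).2.1 = v ++ [none] := by
  cases q
  · exact ⟨[], rfl⟩
  · exact exists_pushStep_bottom _ _ _
  · exact exists_pushStep_bottom _ _ _
  · exact ⟨[], rfl⟩

theorem exists_palDecompress_bottom (a₁ : A) (q : PalState A L N) (b : A ⊕ PalState A L N) :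
    ∃ v, (palDecompress a₁ q none b).2.1 = v ++ [none] := by
  cases b
  · cases q
    · exact ⟨[], rfl⟩
    · exact exists_pushStep_bottom _ _ _
    · exact exists_pushStep_bottom _ _ _
    · exact ⟨[], rfl⟩
  · cases q <;> exact ⟨[], rfl⟩

/-- The state of the decompressor that corresponds to a state of the compressor. -/
def PalState.flush : PalState A L N → PalState A L N
  | .pop _ => .pop (.trunc L [])
  | q => q

theorem PalState.flush_push (p : Buffer A L) :
    (PalState.push p : PalState A L N).flush = .push p := rfl

theorem PalState.flush_pop (p : Buffer A L) :
    (PalState.pop p : PalState A L N).flush = .pop (.trunc L []) := rfl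

theorem exec_palDecompress_copy (a₁ : A) (w : List A) (g : Option (Buffer A L))
    (s : List (Option (Buffer A L))) :
    exec (palDecompress a₁ : PalState A L N → _) .copy (g :: s) (w.map Sum.inl) =
      (w, .copy, g :: s) := by
  induction w with
  | nil => rfl
  | cons b w ih => simp [exec_cons, palDecompress, ih]

theorem exec_singleton {I O Q Γ : Type} {tr : Q → Γ → I → Q × List Γ × List O} (q : Q) (g : Γ)
    (s : List Γ) (b : I) :
    exec tr q (g :: s) [b] = ((tr q g b).2.2, (tr q g b).1, (tr q g b).2.1 ++ s) := by
  simp [exec_cons]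

theorem flush_pushStep (a₁ : A) (p : List A) (g : Option (Buffer A L)) (b : A) :
    (pushStep a₁ p g b : PalState A L N × List (Option (Buffer A L)) × List A).1.flush =
      (pushStep a₁ p g b).1 := by
  unfold pushStep
  split_ifs <;> rfl

theorem pending_pushStep (a₁ : A) (p : List A) (g : Option (Buffer A L)) (b : A) :
    (pushStep a₁ p g b : PalState A L N × List (Option (Buffer A L)) × List A).1.pending = [] := by
  unfold pushStep
  split_ifs <;> simp [PalState.pending, Buffer.trunc]

theorem output_pushStep (a₁ : A) (p : List A) (g : Option (Buffer A L)) (b : A) :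
    (pushStep a₁ p g b : PalState A L N × List (Option (Buffer A L)) × List A).2.2 = [b] := by
  unfold pushStep
  split_ifs <;> rfl

/-- One step of the compressor is followed by the decompressor. -/
theorem palDecompress_step {a₀ a₁ : A} (h01 : a₀ ≠ a₁) (q : PalState A L N)
    (g : Option (Buffer A L)) (s : List (Option (Buffer A L)))
    (hq : g = none → q.pending = []) (b : A) :
    ∃ v, exec (palDecompress a₁) q.flush (g :: s)
        ((palCompress a₀ a₁ q g b).2.2.map Sum.inl) =
      (v, (palCompress a₀ a₁ q g b).1.flush, (palCompress a₀ a₁ q g b).2.1 ++ s) ∧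
      v ++ (palCompress a₀ a₁ q g b).1.pending = q.pending ++ [b] ∧
      (∀ s', (palCompress a₀ a₁ q g b).2.1 ++ s = none :: s' →
        (palCompress a₀ a₁ q g b).1.pending = []) := by
  cases q with
  | copyFor i =>
    refine ⟨[b], ?_, ?_, ?_⟩
    · simp only [palCompress, copyForStep, List.map_cons, List.map_nil, PalState.flush,
        exec_singleton, palDecompress]
      split_ifs <;> simp
    · simp only [palCompress, copyForStep, PalState.pending]
      split_ifs <;> simp
    · intro s' _
      simp only [palCompress, copyForStep]
      split_ifs <;> rfl
  | push p =>
    refine ⟨[b], ?_, ?_, ?_⟩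
    · simp [palCompress, output_pushStep, flush_pushStep, exec_singleton, palDecompress,
        PalState.flush_push]
    · simp [palCompress, pending_pushStep]
      rfl
    · intro s' _
      simp [palCompress, pending_pushStep]
  | copy => exact ⟨[b], by simp [palCompress, exec_singleton, PalState.flush, palDecompress],
      by simp [palCompress, PalState.pending], by simp [palCompress, PalState.pending]⟩
  | pop p =>
    cases g with
    | none =>
      refine ⟨[b], ?_, ?_, ?_⟩
      · simp [palCompress, output_pushStep, flush_pushStep, exec_singleton, palDecompress,
          PalState.flush_pop]
      · simp [palCompress, pending_pushStep, hq rfl]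
      · intro s' _
        simp [palCompress, pending_pushStep]
    | some f =>
      simp only [palCompress]
      split_ifs with h1 h2
      · refine ⟨[], by simp [PalState.flush], ?_, by simp⟩
        simp only [PalState.pending, Buffer.trunc, List.nil_append]
        exact List.take_of_length_le h1.le
      · refine ⟨f.1, ?_, ?_, ?_⟩
        · simp [PalState.flush, exec_singleton, palDecompress]
        · simp [PalState.pending, Buffer.trunc, h2]
        · simp [PalState.pending, Buffer.trunc]
      · refine ⟨p.1 ++ [b], ?_, ?_, by simp⟩
        · rw [List.map_cons, exec_cons]
          simp [PalState.flush, palDecompress, h01, -List.map_append, exec_palDecompress_copy]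
        · simp [PalState.pending]

/-- The decompressor keeps the same stack as the compressor and lags behind it by exactly the
pending word. The last clause of the invariant is needed because the compressor discards its buffer
in popping mode at the bottom of the stack; nothing may be pending there. -/
theorem palDecompress_palCompress {a₀ a₁ : A} (h01 : a₀ ≠ a₁) (q₀ : PalState A L N)
    (h₀ : q₀.pending = []) (h₀' : q₀.flush = q₀) (w : List A) :
    ∃ v, exec (palDecompress a₁) q₀ [none]
        ((exec (palCompress a₀ a₁) q₀ [none] w).1.map Sum.inl) =
      (v, (exec (palCompress a₀ a₁) q₀ [none] w).2.1.flush,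
        (exec (palCompress a₀ a₁) q₀ [none] w).2.2) ∧
      v ++ (exec (palCompress a₀ a₁) q₀ [none] w).2.1.pending = w ∧
      (∀ s', (exec (palCompress a₀ a₁) q₀ [none] w).2.2 = none :: s' →
        (exec (palCompress a₀ a₁) q₀ [none] w).2.1.pending = []) := by
  induction w using List.reverseRecOn with
  | nil => exact ⟨[], by simp [h₀'], by simp [h₀], by simp [h₀]⟩
  | append_singleton w b ih =>
    obtain ⟨v, hv1, hv2, hv3⟩ := ih
    obtain ⟨t, ht⟩ := exec_bottom (exists_palCompress_bottom a₀ a₁) q₀ [] w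
    rw [List.nil_append] at ht
    rcases hC : exec (palCompress a₀ a₁) q₀ [none] w with ⟨o, q, s⟩
    rw [hC] at hv1 hv2 hv3 ht
    dsimp only at hv1 hv2 hv3 ht
    obtain ⟨g, s, rfl⟩ : ∃ g s', s = g :: s' := by
      cases s with
      | nil => simp at ht
      | cons g s => exact ⟨g, s, rfl⟩
    have hg : g = none → q.pending = [] := by
      rintro rfl
      exact hv3 s rfl
    obtain ⟨v', h1, h2, h3⟩ := palDecompress_step h01 q g s hg b
    refine ⟨v ++ v', ?_, ?_, ?_⟩
    · rw [exec_append_of_eq hC, exec_singleton, List.map_append, exec_append_of_eq hv1, h1]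
    · rw [exec_append_of_eq hC, exec_singleton, List.append_assoc, h2, ← List.append_assoc, hv2]
    · rw [exec_append_of_eq hC, exec_singleton]
      exact h3

/-- The output of the palindrome compressor. -/
noncomputable def palOutput (L N : ℕ) (a₀ a₁ : A) (w : List A) : List A :=
  (exec (palCompress a₀ a₁) (.copyFor (Fin.last N) : PalState A L N) [none] w).1

/-- Losslessness comes for free from the decompressor: output and final state determine its input,
hence the original word. -/
theorem isInvPD_palOutput [Finite A] (L N : ℕ) {a₀ a₁ : A} (h01 : a₀ ≠ a₁) :
    IsInvPD (palOutput L N a₀ a₁) := by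
  let q₀ : PalState A L N := .copyFor (Fin.last N)
  let C : PushdownTransducer A A :=
    realTime (palCompress a₀ a₁) q₀ none (exists_palCompress_bottom a₀ a₁)
  let D : PushdownTransducer (A ⊕ C.Q) A :=
    realTime (palDecompress a₁) q₀ none (exists_palDecompress_bottom a₁)
  have hC : ∀ w, C.transduce w = some (palOutput L N a₀ a₁ w,
      (exec (palCompress a₀ a₁) q₀ [none] w).2.1) := fun w => transduce_realTime _ w
  have hD : ∀ w, ∃ q', D.transduce ((palOutput L N a₀ a₁ w).map Sum.inl ++
      [Sum.inr (exec (palCompress a₀ a₁) q₀ [none] w).2.1]) = some (w, q') := by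
    intro w
    obtain ⟨v, h1, h2, -⟩ := palDecompress_palCompress h01 q₀ rfl rfl w
    obtain ⟨t, ht⟩ := exec_bottom (exists_palCompress_bottom a₀ a₁) q₀ [] w
    rw [List.nil_append] at ht
    rcases he : exec (palCompress a₀ a₁) q₀ [none] w with ⟨o, q, s⟩
    rw [he] at h1 h2 ht
    dsimp only at h1 h2 ht
    have ho : palOutput L N a₀ a₁ w = o := by
      unfold palOutput
      rw [he]
    obtain ⟨g, s, rfl⟩ : ∃ g s', s = g :: s' := by
      cases s with
      | nil => simp at ht
      | cons g s => exact ⟨g, s, rfl⟩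
    refine ⟨q.flush, ?_⟩
    refine (transduce_realTime (exists_palDecompress_bottom a₁) _).trans ?_
    rw [ho, exec_append_of_eq h1, exec_singleton]
    simp [palDecompress, h2]
  refine ⟨C, D, ⟨fun w => by rw [hC]; rfl, fun w w' h => ?_⟩, fun w => ?_⟩
  · rw [hC, hC, Option.some.injEq, Prod.mk.injEq] at h
    obtain ⟨q, hq⟩ := hD w
    obtain ⟨q', hq'⟩ := hD w'
    rw [h.1, h.2, hq'] at hq
    exact (congrArg Prod.fst (Option.some.inj hq)).symm
  · obtain ⟨q, hq⟩ := hD w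
    exact ⟨_, q, hC w, hq⟩

/-! ### Runs of the compressor on palindromic blocks. -/

theorem Buffer.trunc_val {l : List A} (h : l.length ≤ L) : (Buffer.trunc L l).1 = l :=
  List.take_of_length_le h

/-- With `p` nonempty, an `a₁` inside the frame is not mistaken for the centre of the block. -/
theorem exec_pushFrame {a₀ a₁ : A} (p u : List A) (hp : p ≠ []) (hu : u ≠ [])
    (h : p.length + u.length = L) (g : Option (Buffer A L)) (s : List (Option (Buffer A L))) :
    exec (palCompress a₀ a₁) (.push (.trunc L p) : PalState A L N) (g :: s) u =
      (u, .push (.trunc L []), some (.trunc L (p ++ u).reverse) :: g :: s) := by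
  induction u generalizing p with
  | nil => exact absurd rfl hu
  | cons b u ih =>
    rw [List.length_cons] at h
    rw [exec_cons]
    simp only [palCompress, Buffer.trunc_val (show p.length ≤ L by omega), pushStep, hp, false_and,
      if_false]
    cases u with
    | nil => simp_all
    | cons b' u =>
      rw [List.length_cons] at h
      rw [if_pos (by simp; omega)]
      simp only [List.singleton_append]
      rw [ih (p ++ [b]) (by simp) (by simp) (by simp; omega)]
      simp

theorem exec_popFrame {a₀ a₁ : A} (f : Buffer A L) (hf : f.1.length = L) (p u : List A)
    (hu : u ≠ []) (h : p ++ u = f.1) (s : List (Option (Buffer A L))) :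
    exec (palCompress a₀ a₁) (.pop (.trunc L p) : PalState A L N) (some f :: s) u =
      ([a₁], .pop (.trunc L []), s) := by
  induction u generalizing p with
  | nil => exact absurd rfl hu
  | cons b u ih =>
    have hl : p.length + (u.length + 1) = L := by
      rw [← hf, ← h]
      simp
    rw [exec_cons]
    simp only [palCompress, Buffer.trunc_val (show p.length ≤ L by omega)]
    have hp : (Buffer.trunc L p).1 = p := Buffer.trunc_val (by omega)
    cases u with
    | nil =>
      rw [if_neg (by simp at hl ⊢; omega), if_pos (by rwa [hp])]
      simp
    | cons b' u =>
      rw [List.length_cons] at hl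
      rw [if_pos (by simp; omega)]
      simp only [List.singleton_append]
      rw [ih (p ++ [b]) (by simp) (by simpa using h)]
      simp

theorem exec_frame {a₀ a₁ : A} (hL : 2 ≤ L) (u : List A) (h : u.length = L)
    (hu : u[0]? ≠ some a₁) (g : Option (Buffer A L)) (s : List (Option (Buffer A L))) :
    exec (palCompress a₀ a₁) (.push (.trunc L []) : PalState A L N) (g :: s) u =
      (u, .push (.trunc L []), some (.trunc L u.reverse) :: g :: s) := by
  cases u with
  | nil => simp at h; omega
  | cons b u =>
    have hb : b ≠ a₁ := by simpa using hu
    have hu : u ≠ [] := by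
      rintro rfl
      simp at h
      omega
    rw [exec_cons]
    simp only [palCompress, Buffer.trunc_val (show ([] : List A).length ≤ L by simp), pushStep, hb,
      and_false, if_false]
    rw [if_pos (by simp; omega)]
    simp only [List.singleton_append, List.nil_append]
    rw [exec_pushFrame [b] u (by simp) hu (by simp at h ⊢; omega)]
    simp

/-- The induction removes the outermost frame: the first frame `u` of `x` lies on the stack,
reversed, while the inner palindrome is processed, and is then matched with the last frame of the
block. The count is `L * n` copied symbols, one for the centre, and one for each matched frame. -/
theorem exec_block {a₀ a₁ : A} (hL : 2 ≤ L) (n : ℕ) (x : List A) (hx : x.length = L * n)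
    (h : ∀ i, x[L * i]? ≠ some a₁) (g : Option (Buffer A L)) (s : List (Option (Buffer A L))) :
    ∃ o : List A, exec (palCompress a₀ a₁) (.push (.trunc L []) : PalState A L N) (g :: s)
        (x ++ a₁ :: x.reverse) = (o, .pop (.trunc L []), g :: s) ∧
      o.length = L * n + 1 + n := by
  induction n generalizing x g s with
  | zero =>
    have : x = [] := by simpa using hx
    subst this
    refine ⟨[a₁], ?_, by simp⟩
    rw [List.reverse_nil, List.nil_append, exec_singleton]
    simp [palCompress, pushStep, Buffer.trunc]
  | succ n ih =>
    obtain ⟨u, y, rfl, hu⟩ : ∃ u y, x = u ++ y ∧ u.length = L :=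
      ⟨x.take L, x.drop L, by simp, by
        rw [List.length_take, hx, Nat.mul_succ]
        omega⟩
    have hy : y.length = L * n := by
      rw [List.length_append, hu, Nat.mul_succ] at hx
      omega
    obtain ⟨o, ho, hol⟩ := ih y hy (fun i => by
      have := h (i + 1)
      rw [List.getElem?_append_right (by rw [hu, Nat.mul_succ]; omega)] at this
      rwa [hu, Nat.mul_succ, Nat.add_sub_cancel] at this)
      (some (.trunc L u.reverse)) (g :: s)
    refine ⟨u ++ (o ++ [a₁]), ?_, ?_⟩
    · rw [show u ++ y ++ a₁ :: (u ++ y).reverse = u ++ ((y ++ a₁ :: y.reverse) ++ u.reverse) by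
        simp, exec_append_of_eq (exec_frame hL u hu ?_ g s), exec_append_of_eq ho,
        exec_popFrame _ ?_ [] u.reverse]
      · intro h0
        rw [List.reverse_eq_nil_iff.mp h0] at hu
        simp at hu
        omega
      · exact (Buffer.trunc_val (by simp [hu])).symm
      · rw [Buffer.trunc_val (by simp [hu])]
        simpa using hu
      · have := h 0
        rwa [Nat.mul_zero, List.getElem?_append_left (by omega)] at this
    · simp only [List.length_append, hu, hol, List.length_singleton, Nat.mul_succ]
      omega

theorem exec_copyFor {a₀ a₁ : A} (i : Fin (N + 1)) (u : List A) (hu : u.length = i.1 + 1)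
    (g : Option (Buffer A L)) (s : List (Option (Buffer A L))) :
    exec (palCompress a₀ a₁) (.copyFor i : PalState A L N) (g :: s) u =
      (u, .push (.trunc L []), g :: s) := by
  obtain ⟨i, hi⟩ := i
  induction i generalizing u with
  | zero =>
    obtain ⟨b, rfl⟩ := List.length_eq_one_iff.mp hu
    rw [exec_singleton]
    simp [palCompress, copyForStep]
  | succ i ih =>
    cases u with
    | nil => simp at hu
    | cons b u =>
      rw [exec_cons]
      simp only [palCompress, copyForStep, Nat.succ_ne_zero, if_false, Nat.add_sub_cancel]
      simp only [List.singleton_append]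
      rw [ih u (by omega) (by simpa using hu)]

theorem palOutput_isPrefix (L N : ℕ) (a₀ a₁ : A) {u v : List A} (h : u <+: v) :
    palOutput L N a₀ a₁ u <+: palOutput L N a₀ a₁ v := by
  obtain ⟨t, rfl⟩ := h
  unfold palOutput
  rw [exec_append]
  exact List.prefix_append _ _

/-- On a sequence of palindromic blocks the palindrome compressor outputs little more than the
first halves. -/
theorem length_palOutput {a₀ a₁ : A} (hL : 2 ≤ L) (W x : ℕ → List A)
    (hW : ∀ j, W (j + 1) = W j ++ (x j ++ a₁ :: (x j).reverse)) (c : ℕ → ℕ) (j₀ : ℕ)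
    (hN : (W j₀).length = N + 1) (hx : ∀ j ≥ j₀, (x j).length = L * c j)
    (h : ∀ j ≥ j₀, ∀ i, (x j)[L * i]? ≠ some a₁) (j : ℕ) (hj : j₀ ≤ j) :
    (palOutput L N a₀ a₁ (W j)).length =
      (W j₀).length + ∑ i ∈ Finset.Ico j₀ j, (L * c i + 1 + c i) := by
  suffices H : ∃ o q, exec (palCompress a₀ a₁) (.copyFor (Fin.last N) : PalState A L N) [none]
      (W j) = (o, q, [none]) ∧ (q = .push (.trunc L []) ∨ q = .pop (.trunc L [])) ∧
      o.length = (W j₀).length + ∑ i ∈ Finset.Ico j₀ j, (L * c i + 1 + c i) by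
    obtain ⟨o, q, h1, -, h2⟩ := H
    rw [palOutput, h1, h2]
  induction j, hj using Nat.le_induction with
  -- Everything before block `j₀` is copied, since `L` need not divide the lengths of the early
  -- halves.
  | base => exact ⟨_, _, exec_copyFor _ _ hN _ _, Or.inl rfl, by simp⟩
  | succ j hj ih =>
    obtain ⟨o, q, h1, h2, h3⟩ := ih
    obtain ⟨o', h4, h5⟩ := exec_block (N := N) (a₀ := a₀) hL (c j) (x j) (hx j hj) (h j hj) none []
    refine ⟨o ++ o', .pop (.trunc L []), ?_, Or.inr rfl, ?_⟩
    · rw [hW, exec_append_of_eq h1]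
      have : exec (palCompress a₀ a₁) q [none] (x j ++ a₁ :: (x j).reverse) =
          (o', .pop (.trunc L []), [none]) := by
        rw [← h4]
        -- At the bottom of the stack, popping mode makes the same transition as pushing mode with
        -- an empty buffer.
        rcases h2 with rfl | rfl
        · rfl
        · cases x j <;> simp [exec_cons, palCompress, Buffer.trunc]
      rw [this]
    · rw [List.length_append, h3, h5, Finset.sum_Ico_succ_top hj, add_assoc]

end Palindromes
end PushdownTransducer

/-! ### Counting the words that an injective online machine reads with short output. -/

namespace OnlineTM

variable {A : Type} {M : OnlineTM A}

/-- The configuration without the output. -/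
def Config.core (c : M.Config) : M.Config := { c with out := [] }

theorem Config.eq_of_core_eq {c d : M.Config} (h : c.core = d.core) (ho : c.out = d.out) :
    c = d := by
  cases c
  cases d
  simp_all [Config.core]

theorem Config.inPos_eq_of_core_eq {c d : M.Config} (h : c.core = d.core) : c.inPos = d.inPos :=
  show c.core.inPos = d.core.inPos by rw [h]

/-- Computations in which the input head is at positions that satisfy `P` before each step. -/
def RunIn (M : OnlineTM A) (w : List A) (P : ℕ → Prop) : M.Config → M.Config → Prop :=
  Relation.ReflTransGen fun a b => P a.inPos ∧ M.step w a = some b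

theorem RunIn.mono {w : List A} {P P' : ℕ → Prop} (hP : ∀ p, P p → P' p) {a b : M.Config}
    (h : M.RunIn w P a b) : M.RunIn w P' a b :=
  Relation.ReflTransGen.mono (fun _ _ h => ⟨hP _ h.1, h.2⟩) _ _ h

theorem RunIn.reaches {w : List A} {P : ℕ → Prop} {a b : M.Config} (h : M.RunIn w P a b) :
    StateTransition.Reaches (M.step w) a b :=
  Relation.ReflTransGen.mono (fun _ _ h => h.2) _ _ h

theorem runIn_of_reaches {w : List A} {a b : M.Config}
    (h : StateTransition.Reaches (M.step w) a b) : M.RunIn w (fun _ => True) a b :=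
  Relation.ReflTransGen.mono (fun _ _ h => ⟨trivial, h⟩) _ _ h

theorem RunIn.eq_of_halted {w : List A} {P : ℕ → Prop} {a b : M.Config} (h : M.RunIn w P a b)
    (ha : M.step w a = none) : b = a := by
  rcases Relation.ReflTransGen.cases_head h with h | ⟨c, hc, -⟩
  · exact h.symm
  · rw [ha] at hc
    simp at hc

theorem step_congr {w w' : List A} (hl : w.length = w'.length) (a : M.Config)
    (h : w[a.inPos]? = w'[a.inPos]?) : M.step w a = M.step w' a := by
  simp only [step, h, hl]

theorem step_eq_none_of_core_eq {w : List A} {a a' : M.Config} (h : a.core = a'.core)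
    (ha : M.step w a = none) : M.step w a' = none := by
  cases a
  cases a'
  simp_all [Config.core, step]

theorem exists_step_of_core_eq {w : List A} {a a' b : M.Config} (h : a.core = a'.core)
    (hab : M.step w a = some b) :
    ∃ b' e, M.step w a' = some b' ∧ b.core = b'.core ∧ b.out = a.out ++ e ∧ b'.out = a'.out ++ e := by
  cases a
  cases a'
  simp only [Config.core, Config.mk.injEq, and_true] at h
  obtain ⟨rfl, rfl, rfl, rfl, rfl⟩ := h
  simp only [step, Option.map_eq_some_iff] at hab ⊢
  obtain ⟨t, ht, rfl⟩ := hab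
  exact ⟨_, t.emit, ⟨t, ht, rfl⟩, rfl, rfl, rfl⟩

/-- The machine never reads its output tape, so runs from configurations with equal core append the
same word as long as the inputs agree on the visited positions. -/
theorem RunIn.transfer {w w' : List A} (hl : w.length = w'.length) {P : ℕ → Prop}
    (hP : ∀ p, P p → w[p]? = w'[p]?) {a a' b : M.Config} (h : a.core = a'.core)
    (hab : M.RunIn w P a b) :
    ∃ b' e, M.RunIn w' P a' b' ∧ b.core = b'.core ∧ b.out = a.out ++ e ∧ b'.out = a'.out ++ e := by
  induction hab with
  | refl => exact ⟨a', [], .refl, h, by simp, by simp⟩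
  | tail _ hs ih =>
    obtain ⟨b', e, h1, h2, h3, h4⟩ := ih
    obtain ⟨hp, hs⟩ := hs
    rw [step_congr hl _ (hP _ hp)] at hs
    obtain ⟨c', e', h5, h6, h7, h8⟩ := exists_step_of_core_eq h2 hs
    exact ⟨c', e ++ e', .tail h1 ⟨Config.inPos_eq_of_core_eq h2 ▸ hp, h5⟩, h6,
      by rw [h7, h3, List.append_assoc], by rw [h8, h4, List.append_assoc]⟩

theorem RunIn.out {w : List A} {P : ℕ → Prop} {a b : M.Config} (h : M.RunIn w P a b) :
    ∃ e, b.out = a.out ++ e := by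
  obtain ⟨_, e, _, _, h, _⟩ := h.transfer rfl (fun _ _ => rfl) rfl
  exact ⟨e, h⟩

theorem RunIn.congr {w w' : List A} (hl : w.length = w'.length) {P : ℕ → Prop}
    (hP : ∀ p, P p → w[p]? = w'[p]?) {a b : M.Config} (hab : M.RunIn w P a b) :
    M.RunIn w' P a b := by
  obtain ⟨b', e, h1, h2, h3, h4⟩ := hab.transfer hl hP rfl
  rwa [Config.eq_of_core_eq h2 (h3.trans h4.symm)]

theorem le_inPos_of_step {w : List A} {i : ℕ} (hi : i ≤ w.length) {a b : M.Config}
    (ha : i ≤ a.inPos) (h : M.step w a = some b) : i ≤ b.inPos := by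
  simp only [step, Option.map_eq_some_iff] at h
  obtain ⟨t, -, rfl⟩ := h
  dsimp only
  split_ifs
  · exact le_min (by omega) hi
  · exact ha

theorem RunIn.restrict {w : List A} {P : ℕ → Prop} {i : ℕ} (hi : i ≤ w.length) {a b : M.Config}
    (ha : i ≤ a.inPos) (h : M.RunIn w P a b) :
    M.RunIn w (fun p => P p ∧ i ≤ p) a b ∧ i ≤ b.inPos := by
  induction h with
  | refl => exact ⟨.refl, ha⟩
  | tail _ hs ih => exact ⟨.tail ih.1 ⟨⟨hs.1, ih.2⟩, hs.2⟩, le_inPos_of_step hi ih.2 hs.2⟩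

/-- `c` is the first configuration on input `w` with input head at position `i` or beyond, or the
halting configuration if there is none. -/
def Visit (M : OnlineTM A) (w : List A) (i : ℕ) (c : M.Config) : Prop :=
  M.RunIn w (· < i) M.init c ∧ (i ≤ c.inPos ∨ M.step w c = none)

theorem exists_runIn_stop {w : List A} (i : ℕ) {a s : M.Config}
    (h : StateTransition.Reaches (M.step w) a s) (hs : M.step w s = none) :
    ∃ c, M.RunIn w (· < i) a c ∧ (i ≤ c.inPos ∨ M.step w c = none) ∧
      StateTransition.Reaches (M.step w) c s := by
  induction h using Relation.ReflTransGen.head_induction_on with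
  | refl => exact ⟨s, .refl, Or.inr hs, .refl⟩
  | head hab hbs ih =>
    rename_i a b
    by_cases ha : i ≤ a.inPos
    · exact ⟨a, .refl, Or.inl ha, .head hab hbs⟩
    · obtain ⟨c, h1, h2, h3⟩ := ih
      exact ⟨c, .head ⟨by omega, hab⟩ h1, h2, h3⟩

/-- On some input `w` of length `n` that contains `y` at position `i`, the machine is in the
configurations `c` and `c'` before and after reading `y`. -/
def Segment (M : OnlineTM A) (n : ℕ) (y : List A) (i : ℕ) (c c' : M.Config) : Prop :=
  ∃ w : List A, w.length = n ∧ i + y.length ≤ n ∧ (∀ p < y.length, w[i + p]? = y[p]?) ∧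
    M.Visit w i c ∧ M.RunIn w (· < i + y.length) c c' ∧
    (i + y.length ≤ c'.inPos ∨ M.step w c' = none)

/-- An injective machine can reconstruct the part of the input that it has read between two
configurations from these configurations and the output in between. -/
theorem Segment.eq {T : List A → List A} (hT : M.Computes T) (hinj : Function.Injective T)
    {n i : ℕ} {y y' : List A} (hy : y.length = y'.length) {c c' d d' : M.Config}
    (h : M.Segment n y i c c') (h' : M.Segment n y' i d d') (hc : c.core = d.core)
    (hc' : c'.core = d'.core) {u : List A} (hu : c'.out = c.out ++ u) (hu' : d'.out = d.out ++ u) :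
    y = y' := by
  obtain ⟨w, hw, him, hyw, ⟨hV, hVs⟩, hR, hRs⟩ := h
  obtain ⟨w', hw', -, hyw', ⟨hV', hVs'⟩, hR', hRs'⟩ := h'
  -- `x` is `w` with `y` replaced by `y'`. The machine will be shown to have the same output on `x`
  -- as on `w`.
  obtain ⟨x, hx, hxi, hxy, hxw⟩ : ∃ x : List A, x.length = n ∧ (∀ p < i, w[p]? = x[p]?) ∧
      (∀ p, i ≤ p → p < i + y.length → w'[p]? = x[p]?) ∧
      (∀ p, i + y.length ≤ p → w[p]? = x[p]?) := by
    refine ⟨w.take i ++ (y' ++ w.drop (i + y.length)), ?_, ?_, ?_, ?_⟩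
    · simp
      omega
    · intro p hp
      rw [List.getElem?_append_left (by simp; omega), List.getElem?_take_of_lt hp]
    · intro p hp hp'
      have := hyw' (p - i) (by omega)
      rw [Nat.add_sub_cancel' hp] at this
      rw [List.getElem?_append_right (by simp; omega), List.length_take,
        List.getElem?_append_left (by omega), this]
      congr 1
      omega
    · intro p hp
      rw [List.getElem?_append_right (by simp; omega), List.length_take,
        List.getElem?_append_right (by omega), List.getElem?_drop]
      congr 1
      omega
  have hwx : w.length = x.length := hw.trans hx.symm
  have hwx' : w'.length = x.length := hw'.trans hx.symm
  -- On `x` the machine follows `w` up to `c`, and then the run on `w'` from `d` to `d'`,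
  -- transferred to start at `c`; equal cores and equal output `u` make it end in `c'` exactly.
  have hreach : StateTransition.Reaches (M.step x) M.init c' := by
    refine Relation.ReflTransGen.trans (hV.congr hwx hxi).reaches ?_
    rcases hVs' with hd | hd
    · obtain ⟨b', e, h1, h2, h3, h4⟩ := (hR'.restrict (by omega) hd).1.transfer hwx'
        (fun p hp => hxy p hp.2 (by omega)) hc.symm
      have he : e = u := List.append_cancel_left (h3.symm.trans hu')
      have hb : b' = c' := Config.eq_of_core_eq (h2.symm.trans hc'.symm) (by rw [h4, he, hu])
      exact hb ▸ h1.reaches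
    · obtain rfl := hR'.eq_of_halted hd
      have : u = [] := by simpa using hu'
      subst this
      have : c = c' := Config.eq_of_core_eq (hc.trans hc'.symm) (by simpa using hu.symm)
      subst this
      exact .refl
  obtain ⟨s, hs, hs', hsT⟩ := hT w
  have hcs : StateTransition.Reaches (M.step w) c' s := by
    rcases StateTransition.reaches_total (hV.reaches.trans hR.reaches) hs with h | h
    · exact h
    · rw [(runIn_of_reaches h).eq_of_halted hs']
      exact .refl
  -- From `c'` on, `x` agrees with `w` again and the one-way head cannot return to the replaced
  -- part. The second case is a machine that halts before it has read all of `y`.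
  have hxs : StateTransition.Reaches (M.step x) M.init s ∧ M.step x s = none := by
    by_cases hp : i + y.length ≤ c'.inPos
    · obtain ⟨h1, h2⟩ := (runIn_of_reaches hcs).restrict (by omega) hp
      refine ⟨hreach.trans (h1.congr hwx fun p hp => hxw p hp.2).reaches, ?_⟩
      rw [← step_congr hwx _ (hxw _ h2), hs']
    · have hh : M.step w c' = none := hRs.resolve_left hp
      obtain rfl := (runIn_of_reaches hcs).eq_of_halted hh
      refine ⟨hreach, ?_⟩
      by_cases hi : s.inPos < i
      · rw [← step_congr hwx _ (hxi _ hi), hs']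
      · rw [← step_congr hwx' _ (hxy _ (by omega) (by omega))]
        refine step_eq_none_of_core_eq hc'.symm (hRs'.resolve_left ?_)
        rw [← Config.inPos_eq_of_core_eq hc']
        omega
  obtain ⟨t, ht, ht', htT⟩ := hT x
  have hst : s = t :=
    Part.mem_unique (StateTransition.mem_eval.2 hxs) (StateTransition.mem_eval.2 ⟨ht, ht'⟩)
  have hwx0 : w = x := hinj (by rw [← hsT, ← htT, hst])
  refine List.ext_getElem? fun p => ?_
  by_cases hp : p < y.length
  · rw [← hyw p hp, ← hyw' p (by omega), hwx0, hxy (i + p) (by omega) (by omega)]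
  · rw [List.getElem?_eq_none (by omega), List.getElem?_eq_none (by omega)]

/-- On some input of length `n` that contains `y`, the machine outputs at most `r` symbols while
it reads `y`. -/
def ShortOutput (M : OnlineTM A) (r n : ℕ) (y : List A) : Prop :=
  ∃ i c c', M.Segment n y i c c' ∧ c'.out.length ≤ c.out.length + r

/-- A bound for the components of a configuration. -/
def Config.Bounded (F S : ℕ) (c : M.Config) : Prop :=
  c.inPos ≤ F ∧ c.lenPos ≤ F ∧ c.head ≤ S ∧ ∀ p, S < p → c.tape p = M.blank

/-- Cells beyond `S` are still blank because the head has never been there. -/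
theorem bounded_of_reaches {F S : ℕ} {w : List A} (hw : w.length ≤ F)
    (hS : ∀ s, StateTransition.Reaches (M.step w) M.init s → s.head ≤ S) {c : M.Config}
    (hc : StateTransition.Reaches (M.step w) M.init c) : c.Bounded F S := by
  suffices c.inPos ≤ F ∧ c.lenPos ≤ F ∧ ∀ p, S < p → c.tape p = M.blank from
    ⟨this.1, this.2.1, hS c hc, this.2.2⟩
  have hbits : (Nat.bits w.length).length ≤ F :=
    (Nat.size_eq_bits_len w.length).le.trans ((Nat.size_le.2 Nat.lt_two_pow_self).trans hw)
  induction hc with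
  | refl => exact ⟨Nat.zero_le _, Nat.zero_le _, fun _ _ => rfl⟩
  | tail hb hs ih =>
    rename_i b c
    have hh := hS b hb
    simp only [step, Option.mem_def, Option.map_eq_some_iff] at hs
    obtain ⟨t, -, rfl⟩ := hs
    refine ⟨?_, ?_, fun p hp => ?_⟩
    · dsimp only
      split_ifs
      · exact (min_le_right _ _).trans hw
      · exact ih.1
    · exact (min_le_right _ _).trans hbits
    · dsimp only
      rw [Function.update_of_ne (by omega)]
      exact ih.2.2 p hp

/-- The finite data that determine the core of a bounded configuration. -/
abbrev ConfigCode (M : OnlineTM A) (F S : ℕ) : Type :=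
  Fin M.numStates × Fin (F + 1) × Fin (F + 1) × Fin (S + 1) × (Fin (S + 1) → Fin M.numSymbols)

/-- The code of a bounded configuration. -/
def Config.code (F S : ℕ) (c : M.Config) : M.ConfigCode F S :=
  (c.state, Fin.ofNat (F + 1) c.inPos, Fin.ofNat (F + 1) c.lenPos, Fin.ofNat (S + 1) c.head,
    fun p => c.tape p)

theorem Config.core_eq_of_code_eq {F S : ℕ} {c d : M.Config} (hc : c.Bounded F S)
    (hd : d.Bounded F S) (h : c.code F S = d.code F S) : c.core = d.core := by
  obtain ⟨h1, h2, h3, h4⟩ := hc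
  obtain ⟨h1', h2', h3', h4'⟩ := hd
  have key : ∀ {N a b : ℕ}, a ≤ N → b ≤ N → Fin.ofNat (N + 1) a = Fin.ofNat (N + 1) b → a = b := by
    intro N a b ha hb hab
    have := congrArg Fin.val hab
    simpa [Fin.ofNat, Nat.mod_eq_of_lt (Nat.lt_succ_of_le ha),
      Nat.mod_eq_of_lt (Nat.lt_succ_of_le hb)] using this
  simp only [code, Prod.mk.injEq] at h
  obtain ⟨e1, e2, e3, e4, e5⟩ := h
  have e2 := key h1 h1' e2
  have e3 := key h2 h2' e3
  have e4 := key h3 h3' e4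
  have e5 : c.tape = d.tape := by
    funext p
    by_cases hp : S < p
    · rw [h4 p hp, h4' p hp]
    · exact congrFun e5 ⟨p, by omega⟩
  cases c
  cases d
  simp_all [core]

theorem exists_finset_lists [Fintype A] (hA : 2 ≤ Fintype.card A) (r : ℕ) :
    ∃ U : Finset (List A), (∀ l, l ∈ U ↔ l.length ≤ r) ∧ U.card ≤ Fintype.card A ^ (r + 1) := by
  classical
  refine ⟨(Finset.range (r + 1)).biUnion fun t =>
    Finset.univ.image fun f : Fin t → A => List.ofFn f, fun l => ?_, ?_⟩
  · simp only [Finset.mem_biUnion, Finset.mem_range, Finset.mem_image, Finset.mem_univ, true_and]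
    constructor
    · rintro ⟨t, ht, f, rfl⟩
      simp
      omega
    · intro h
      exact ⟨l.length, by omega, l.get, List.ofFn_get l⟩
  · refine Finset.card_biUnion_le.trans ?_
    refine (Finset.sum_le_sum (g := fun t => Fintype.card A ^ t) fun t _ => ?_).trans
      (Nat.geomSum_lt hA (by simp)).le
    refine Finset.card_image_le.trans ?_
    simp

theorem card_configCode (M : OnlineTM A) (F S : ℕ) :
    Fintype.card (M.ConfigCode F S) =
      M.numStates * ((F + 1) * ((F + 1) * ((S + 1) * M.numSymbols ^ (S + 1)))) := by
  simp [Fintype.card_prod]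

-- A word with short output is encoded by the input length, its position, the codes of the
-- configurations before and after it, and the output in between; `Segment.eq` makes this encoding
-- injective.
open Classical in
theorem card_filter_shortOutput [Fintype A] (hA : 2 ≤ Fintype.card A) {T : List A → List A}
    (hT : M.Computes T) (hinj : Function.Injective T) {F S : ℕ}
    (hS : ∀ w : List A, w.length ≤ F → ∀ s,
      StateTransition.Reaches (M.step w) M.init s → s.head ≤ S)
    (r m : ℕ) (X : Finset (List A)) (hX : ∀ y ∈ X, y.length = m) :
    (X.filter fun y => ∃ n ≤ F, M.ShortOutput r n y).card ≤
      (F + 1) * ((F + 1) * (Fintype.card (M.ConfigCode F S) *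
        (Fintype.card (M.ConfigCode F S) * Fintype.card A ^ (r + 1)))) := by
  obtain ⟨U, hU, hUc⟩ := exists_finset_lists hA r
  have H : ∀ y : List A, ∃ (n i : ℕ) (c c' : M.Config) (u : List A),
      (∃ n ≤ F, M.ShortOutput r n y) → n ≤ F ∧ i ≤ F ∧ M.Segment n y i c c' ∧
        c'.out = c.out ++ u ∧ u.length ≤ r ∧ c.Bounded F S ∧ c'.Bounded F S := by
    intro y
    by_cases hy : ∃ n ≤ F, M.ShortOutput r n y
    · obtain ⟨n, hn, i, c, c', hs, hl⟩ := hy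
      obtain ⟨w, hw, hi, -, hV, hR, -⟩ := id hs
      obtain ⟨u, hu⟩ := hR.out
      refine ⟨n, i, c, c', u, fun _ => ⟨hn, by omega, hs, hu, ?_, ?_, ?_⟩⟩
      · rw [hu, List.length_append] at hl
        omega
      · exact bounded_of_reaches (hw.le.trans hn) (hS w (hw.le.trans hn)) hV.1.reaches
      · exact bounded_of_reaches (hw.le.trans hn) (hS w (hw.le.trans hn))
          (hV.1.reaches.trans hR.reaches)
    · exact ⟨0, 0, M.init, M.init, [], fun h => absurd h hy⟩
  choose n i c c' u H using H
  refine (Finset.card_le_card_of_injOn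
    (t := Finset.range (F + 1) ×ˢ Finset.range (F + 1) ×ˢ
      (Finset.univ : Finset (M.ConfigCode F S)) ×ˢ (Finset.univ : Finset (M.ConfigCode F S)) ×ˢ U)
    (fun y => (n y, i y, (c y).code F S, (c' y).code F S, u y)) ?_ ?_).trans ?_
  · intro y hy
    obtain ⟨h1, h2, h3, h4, h5, h6⟩ := H y (Finset.mem_filter.1 hy).2
    simp [hU, h5]
    omega
  · intro y hy y' hy' he
    obtain ⟨hy0, hy⟩ := Finset.mem_filter.1 hy
    obtain ⟨hy0', hy'⟩ := Finset.mem_filter.1 hy'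
    obtain ⟨h1, h2, h3, h4, h5, h6, h7⟩ := H y hy
    obtain ⟨h1', h2', h3', h4', h5', h6', h7'⟩ := H y' hy'
    simp only [Prod.mk.injEq] at he
    obtain ⟨e1, e2, e3, e4, e5⟩ := he
    rw [← e1, ← e2] at h3'
    rw [← e5] at h4'
    exact h3.eq hT hinj ((hX y hy0).trans (hX y' hy0').symm) h3'
      (Config.core_eq_of_code_eq h6 h6' e3) (Config.core_eq_of_code_eq h7 h7' e4) h4 h4'
  · simp only [Finset.card_product, Finset.card_range, Finset.card_univ]
    gcongr

instance [Countable A] (m k : ℕ) : Countable (OnlineAction A m k) := by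
  refine Function.Injective.countable
    (f := fun a : OnlineAction A m k => (a.next, a.advance,
      (match a.lenMove with | .left => (0 : ℕ) | .stay => 1 | .right => 2), a.write,
      (match a.workMove with | .left => (0 : ℕ) | .stay => 1 | .right => 2), a.emit)) ?_
  rintro ⟨n, a, l, w, v, e⟩ ⟨n', a', l', w', v', e'⟩ h
  cases l <;> cases l' <;> cases v <;> cases v' <;> simp_all

/-- Countability is what permits a single sequence to defeat all machines. -/
instance [Finite A] : Countable (OnlineTM A) := by
  have (m k : ℕ) : Countable (Fin m × Fin k ×
      (Fin m → Option A → Option Bool → Fin k → Option (OnlineAction A m k))) := by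
    have : Countable (Fin m → Option A → Option Bool → Fin k → Option (OnlineAction A m k)) :=
      inferInstance
    infer_instance
  refine Function.Injective.countable
    (β := Σ m k : ℕ, Fin m × Fin k ×
      (Fin m → Option A → Option Bool → Fin k → Option (OnlineAction A m k)))
    (f := fun M => ⟨M.numStates, M.numSymbols, M.start, M.blank, M.act⟩) ?_
  rintro ⟨m, k, s, b, a⟩ ⟨m', k', s', b', a'⟩ h
  simp only [Sigma.mk.injEq] at h
  obtain ⟨rfl, h⟩ := h
  simp only [heq_eq_eq, Sigma.mk.injEq] at h
  obtain ⟨rfl, h⟩ := h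
  simp_all

end OnlineTM

/-! ### Output on a concatenation of hard blocks. -/

namespace OnlineTM

variable {A : Type} {M : OnlineTM A}

theorem Visit.extend {w : List A} {i i' : ℕ} (hi : i ≤ i') {c s : M.Config} (hc : M.Visit w i c)
    (h : StateTransition.Reaches (M.step w) c s) (hs : M.step w s = none) :
    ∃ c', M.Visit w i' c' ∧ M.RunIn w (· < i') c c' ∧
      (i' ≤ c'.inPos ∨ M.step w c' = none) ∧ StateTransition.Reaches (M.step w) c' s := by
  obtain ⟨c', h1, h2, h3⟩ := exists_runIn_stop i' h hs
  exact ⟨c', ⟨Relation.ReflTransGen.trans (hc.1.mono fun _ h => lt_of_lt_of_le h hi) h1, h2⟩, h1, h2, h3⟩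

theorem Visit.read {w y : List A} {i r : ℕ} (hi : i + y.length ≤ w.length)
    (hy : ∀ p < y.length, w[i + p]? = y[p]?) (hr : ¬ M.ShortOutput r w.length y) {c s : M.Config}
    (hc : M.Visit w i c) (h : StateTransition.Reaches (M.step w) c s) (hs : M.step w s = none) :
    ∃ c', M.Visit w (i + y.length) c' ∧ c.out.length + r ≤ c'.out.length ∧
      StateTransition.Reaches (M.step w) c' s := by
  obtain ⟨c', h1, h2, h3, h4⟩ := hc.extend (Nat.le_add_right i y.length) h hs
  refine ⟨c', h1, ?_, h4⟩
  by_contra hlt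
  exact hr ⟨i, c, c', ⟨w, rfl, hi, hy, hc, h2, h3⟩, by omega⟩

theorem Visit.read_block {w u x t : List A} {a : A} {r : ℕ}
    (hw : w = u ++ (x ++ a :: x.reverse) ++ t) (hr : ¬ M.ShortOutput r w.length x)
    (hr' : ¬ M.ShortOutput r w.length x.reverse) {c s : M.Config}
    (hc : M.Visit w u.length c) (h : StateTransition.Reaches (M.step w) c s)
    (hs : M.step w s = none) :
    ∃ c', M.Visit w (u ++ (x ++ a :: x.reverse)).length c' ∧
      c.out.length + 2 * r ≤ c'.out.length ∧ StateTransition.Reaches (M.step w) c' s := by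
  have hl : w.length = u.length + (x.length + (x.length + 1)) + t.length := by
    rw [hw]
    simp
    omega
  obtain ⟨c₁, h1, h2, h3⟩ := hc.read (y := x) (by omega) (fun p hp => by
    rw [hw, List.getElem?_append_left (by simp; omega), List.getElem?_append_right (by omega),
      Nat.add_sub_cancel_left, List.getElem?_append_left hp]) hr h hs
  obtain ⟨c₂, h4, h5, -, h6⟩ := h1.extend (Nat.le_succ _) h3 hs
  obtain ⟨c₃, h7, h8, h9⟩ := h4.read (y := x.reverse) (by simp; omega) (fun p hp => by
    rw [List.length_reverse] at hp
    rw [hw, List.getElem?_append_left (by simp; omega), List.getElem?_append_right (by omega),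
      List.getElem?_append_right (by omega),
      show u.length + x.length + 1 + p - u.length - x.length = p + 1 by omega,
      List.getElem?_cons_succ]) hr' h6 hs
  refine ⟨c₃, ?_, ?_, h9⟩
  · convert h7 using 1
    simp
    omega
  · obtain ⟨e, he⟩ := h5.out
    rw [he, List.length_append] at h8
    omega

/-- A machine outputs much on inputs that consist of blocks for none of which its output is
short. -/
theorem le_length_of_blocks {T : List A → List A} (hT : M.Computes T) {W x : ℕ → List A} {a : A}
    (hW : ∀ j, W (j + 1) = W j ++ (x j ++ a :: (x j).reverse)) {r : ℕ → ℕ} {w : List A}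
    {j₁ J : ℕ} (hJ : j₁ ≤ J) (hw : W J <+: w)
    (hr : ∀ j, j₁ ≤ j → j < J → ¬ M.ShortOutput (r j) w.length (x j) ∧
      ¬ M.ShortOutput (r j) w.length (x j).reverse) :
    ∑ j ∈ Finset.Ico j₁ J, 2 * r j ≤ (T w).length := by
  obtain ⟨s, hs, hs', hsT⟩ := hT w
  suffices H : ∃ c, M.Visit w (W J).length c ∧ StateTransition.Reaches (M.step w) c s ∧
      ∑ j ∈ Finset.Ico j₁ J, 2 * r j ≤ c.out.length by
    obtain ⟨c, -, hc, h⟩ := H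
    obtain ⟨e, he⟩ := (runIn_of_reaches hc).out
    rw [← hsT, he, List.length_append]
    omega
  induction J, hJ using Nat.le_induction with
  | base =>
    obtain ⟨c, h1, h2, h3⟩ := exists_runIn_stop (W j₁).length hs hs'
    exact ⟨c, ⟨h1, h2⟩, h3, by simp⟩
  | succ J hJ ih =>
    obtain ⟨c, h1, h2, h3⟩ := ih ((hW J ▸ List.prefix_append _ _).trans hw)
      (fun j hj hj' => hr j hj (by omega))
    obtain ⟨t, ht⟩ := hw
    rw [hW] at ht
    obtain ⟨hr1, hr2⟩ := hr J hJ (by omega)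
    obtain ⟨c', h4, h5, h6⟩ := h1.read_block ht.symm hr1 hr2 h2 hs'
    refine ⟨c', hW J ▸ h4, h6, ?_⟩
    rw [Finset.sum_Ico_succ_top hJ]
    omega

end OnlineTM

/-! ### Diagonalization against countably many bad properties. -/

open Classical in
/-- A sequence of elements of finite sets can avoid countably many sequences of small sets. -/
theorem exists_forall_eventually_not {ι β : Type*} [Countable ι] (X : ℕ → Finset β)
    (hX : ∀ j, (X j).Nonempty) (B : ι → ℕ → β → Prop)
    (h : ∀ i, ∀ᶠ j in atTop, ((X j).filter (B i j)).card * (j + 2) ≤ (X j).card) :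
    ∃ x : ℕ → β, (∀ j, x j ∈ X j) ∧ ∀ i, ∀ᶠ j in atTop, ¬ B i j (x j) := by
  obtain ⟨e, he⟩ := exists_injective_nat ι
  let P : ι → ℕ → Prop := fun i j => ((X j).filter (B i j)).card * (j + 2) ≤ (X j).card
  -- Including `P i j` makes the size bound hold for all `n` and `j`, even before the hypothesis on
  -- `i` takes effect.
  let D : ℕ → ℕ → Finset β := fun n j => (X j).filter fun y => ∃ i, e i = n ∧ P i j ∧ B i j y
  have hD : ∀ n j, (D n j).card * (j + 2) ≤ (X j).card := by
    intro n j
    by_cases hn : ∃ i, e i = n ∧ P i j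
    · obtain ⟨i, rfl, hi⟩ := hn
      refine le_trans (Nat.mul_le_mul_right _ (Finset.card_le_card ?_)) hi
      intro y hy
      obtain ⟨hy, i', hi', -, hB⟩ := Finset.mem_filter.1 hy
      exact Finset.mem_filter.2 ⟨hy, he hi' ▸ hB⟩
    · have : D n j = ∅ := Finset.filter_eq_empty_iff.2 fun y _ ⟨i, h1, h2, _⟩ => hn ⟨i, h1, h2⟩
      simp [this]
  -- Stage `j` avoids only `j + 1` sets, which together cover at most the fraction `(j + 1) / (j +
  -- 2)` of `X j`.
  have hx : ∀ j, ∃ y ∈ X j, ∀ n < j + 1, y ∉ D n j := by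
    intro j
    by_contra! hcon
    have hsub : X j ⊆ (Finset.range (j + 1)).biUnion fun n => D n j := by
      intro y hy
      obtain ⟨n, hn, hy⟩ := hcon y hy
      exact Finset.mem_biUnion.2 ⟨n, Finset.mem_range.2 hn, hy⟩
    have h1 : (X j).card ≤ ∑ n ∈ Finset.range (j + 1), (D n j).card :=
      (Finset.card_le_card hsub).trans Finset.card_biUnion_le
    have h2 : (∑ n ∈ Finset.range (j + 1), (D n j).card) * (j + 2) ≤ (j + 1) * (X j).card := by
      rw [Finset.sum_mul]
      refine (Finset.sum_le_sum fun n _ => hD n j).trans ?_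
      simp
    have h3 := (hX j).card_pos
    nlinarith
  choose x hx hx' using hx
  refine ⟨x, hx, fun i => ?_⟩
  filter_upwards [h i, eventually_ge_atTop (e i)] with j hj hij hB
  exact hx' j (e i) (by omega) (Finset.mem_filter.2 ⟨hx j, i, rfl, hj, hB⟩)

/-! ### Framed words. -/

section Framed

variable {A : Type} [Fintype A]

open Classical in
/-- Concatenations of `g` words that consist of `a₀` and `k` arbitrary symbols. -/
noncomputable def framedWords (a₀ : A) (k : ℕ) : ℕ → Finset (List A)
  | 0 => {[]}
  | g + 1 => (Finset.univ ×ˢ framedWords a₀ k g).image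
      fun p : (Fin k → A) × List A => (a₀ :: List.ofFn p.1) ++ p.2

theorem mem_framedWords_succ {a₀ : A} {k g : ℕ} {y : List A} :
    y ∈ framedWords a₀ k (g + 1) ↔
      ∃ (p : Fin k → A) (z : List A), z ∈ framedWords a₀ k g ∧ (a₀ :: List.ofFn p) ++ z = y := by
  simp [framedWords]

theorem length_of_mem_framedWords {a₀ : A} {k g : ℕ} {y : List A} (hy : y ∈ framedWords a₀ k g) :
    y.length = (k + 1) * g := by
  induction g generalizing y with
  | zero => simpa [framedWords] using hy
  | succ g ih =>
    obtain ⟨p, z, hz, rfl⟩ := mem_framedWords_succ.1 hy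
    rw [List.length_append, ih hz, List.length_cons, List.length_ofFn]
    ring

open Classical in
theorem card_framedWords (a₀ : A) (k g : ℕ) :
    (framedWords a₀ k g).card = Fintype.card A ^ (k * g) := by
  induction g with
  | zero => simp [framedWords]
  | succ g ih =>
    rw [framedWords, Finset.card_image_of_injective, Finset.card_product, ih, Finset.card_univ,
      Fintype.card_fun, Fintype.card_fin]
    · ring
    · rintro ⟨p, z⟩ ⟨p', z'⟩ h
      obtain ⟨h1, h2⟩ := List.append_inj h (by simp)
      simp only [List.cons.injEq, true_and] at h1
      rw [List.ofFn_injective h1, show z = z' from h2]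

theorem getElem?_ne_of_mem_framedWords {a₀ a₁ : A} (h : a₀ ≠ a₁) {k g : ℕ} {y : List A}
    (hy : y ∈ framedWords a₀ k g) (i : ℕ) : y[(k + 1) * i]? ≠ some a₁ := by
  induction g generalizing y i with
  | zero =>
    have : y = [] := by simpa [framedWords] using hy
    simp [this]
  | succ g ih =>
    obtain ⟨p, z, hz, rfl⟩ := mem_framedWords_succ.1 hy
    cases i with
    | zero => simpa using h
    | succ i =>
      rw [List.getElem?_append_right (by simp [Nat.mul_succ])]
      simpa [Nat.mul_succ] using ih hz i

end Framed

/-! ### Infinite sequences from nested prefixes. -/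

section Sequences

variable {A : Type}

theorem length_seqPrefix (S : ℕ → A) (n : ℕ) : (seqPrefix S n).length = n := by
  simp [seqPrefix]

theorem seqPrefix_isPrefix (S : ℕ → A) {m n : ℕ} (h : m ≤ n) :
    seqPrefix S m <+: seqPrefix S n := by
  obtain ⟨d, rfl⟩ := Nat.exists_eq_add_of_le h
  rw [seqPrefix, seqPrefix, List.range_add, List.map_append]
  exact List.prefix_append _ _

theorem exists_seqPrefix_eq [Nonempty A] (W : ℕ → List A) (hW : ∀ j, W j <+: W (j + 1))
    (hl : ∀ j, j ≤ (W j).length) : ∃ S : ℕ → A, ∀ j, seqPrefix S (W j).length = W j := by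
  have hmono : ∀ {i j}, i ≤ j → W i <+: W j := by
    intro i j hij
    induction j, hij using Nat.le_induction with
    | base => exact List.prefix_rfl
    | succ j _ ih => exact ih.trans (hW j)
  refine ⟨fun n => (W (n + 1))[n]'(hl (n + 1)), fun j => ?_⟩
  refine List.ext_getElem (length_seqPrefix _ _) fun p h1 h2 => ?_
  simp only [seqPrefix, List.getElem_map, List.getElem_range]
  rcases le_total (p + 1) j with h | h
  · exact (hmono h).getElem _
  · exact ((hmono h).getElem _).symm

theorem eventually_of_blocks {P : ℕ → ℕ} (hP : StrictMono P) {R : ℕ → Prop}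
    (h : ∀ᶠ j in atTop, ∀ n, P j ≤ n → n < P (j + 1) → R n) : ∀ᶠ n in atTop, R n := by
  obtain ⟨J, hJ⟩ := eventually_atTop.1 h
  refine eventually_atTop.2 ⟨P J, fun n hn => ?_⟩
  have hex : ∃ j, n < P (j + 1) := ⟨n, (Nat.lt_succ_self n).trans_le (hP.id_le _)⟩
  classical
  have h1 := Nat.find_spec hex
  have h2 : P (Nat.find hex) ≤ n := by
    rcases Nat.eq_zero_or_pos (Nat.find hex) with h0 | h0
    · rw [h0]
      exact (hP.monotone (Nat.zero_le J)).trans hn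
    · have := Nat.find_min hex (m := Nat.find hex - 1) (by omega)
      rw [Nat.sub_add_cancel h0] at this
      omega
  refine hJ _ ?_ n h2 h1
  have := hP.lt_iff_lt.1 (hn.trans_lt h1)
  omega

end Sequences

/-! ### Block sizes and growth estimates. -/

section Growth

/-- The largest power of two that is at most `j + 1`. -/
def scale (j : ℕ) : ℕ := 2 ^ Nat.log 2 (j + 1)

theorem scale_le (j : ℕ) : scale j ≤ j + 1 := Nat.pow_log_le_self 2 (by omega)

theorem lt_two_mul_scale (j : ℕ) : j + 1 < 2 * scale j := by
  have := Nat.lt_pow_succ_log_self (b := 2) (by norm_num) (j + 1)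
  rw [pow_succ] at this
  rw [scale]
  omega

theorem sq_le_four_mul_sum_scale (J : ℕ) : J ^ 2 ≤ 4 * ∑ j ∈ Finset.range J, scale j := by
  induction J with
  | zero => simp
  | succ J ih =>
    have := lt_two_mul_scale J
    rw [Finset.sum_range_succ]
    nlinarith

theorem sum_scale_le_sq (J : ℕ) : ∑ j ∈ Finset.range J, scale j ≤ J ^ 2 := by
  induction J with
  | zero => simp
  | succ J ih =>
    have := scale_le J
    rw [Finset.sum_range_succ]
    nlinarith

theorem tendsto_log_succ : Tendsto (fun j => Nat.log 2 (j + 1)) atTop atTop := by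
  refine tendsto_atTop.2 fun b => ?_
  filter_upwards [eventually_ge_atTop (2 ^ b)] with j hj
  exact Nat.le_log_of_pow_le (by norm_num) (hj.trans (Nat.le_succ j))

theorem eventually_mul_pow_le_two_pow (C e : ℕ) :
    ∀ᶠ l : ℕ in atTop, C * (5 * (l + 2)) ^ e ≤ 2 ^ l := by
  have h := tendsto_pow_const_div_const_pow_of_one_lt e (r := (2 : ℝ)) (by norm_num)
  have h' := h.const_mul ((C : ℝ) * 15 ^ e)
  rw [mul_zero] at h'
  filter_upwards [h'.eventually_le_const one_pos, eventually_ge_atTop 1] with l hl hl1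
  rw [← mul_div_assoc, div_le_one (by positivity)] at hl
  have hl' : C * 15 ^ e * l ^ e ≤ 2 ^ l := by exact_mod_cast hl
  refine le_trans ?_ hl'
  rw [mul_assoc, ← mul_pow]
  exact Nat.mul_le_mul_left _ (Nat.pow_le_pow_left (by omega) _)

/-- The number of codes of a configuration and an output is negligible in comparison with the number
of words of a given length. -/
theorem eventually_count (a b e s : ℕ) (hs : 2 ≤ s) : ∀ᶠ j : ℕ in atTop,
    ∀ F S K : ℕ, F = (j + 1) ^ 5 → S = (Nat.log 2 F + 2) ^ e →
      K = a * ((F + 1) * ((F + 1) * ((S + 1) * b ^ (S + 1)))) →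
      2 * ((F + 1) * ((F + 1) * (K * (K * s)))) * (j + 2) ≤ s ^ scale j := by
  filter_upwards [tendsto_log_succ.eventually
    (eventually_mul_pow_le_two_pow (2 * a + 2 * b + s + 10) (e + 1))] with j hj F S K hF hS hK
  set l := Nat.log 2 (j + 1) with hl
  -- `V` is polylogarithmic in `j`; each factor of the count is bounded by a power of two with
  -- exponent linear in `V`.
  set V := (5 * (l + 2)) ^ (e + 1) with hV
  have hjl : j + 1 < 2 ^ (l + 1) := Nat.lt_pow_succ_log_self (by norm_num) _
  have hV1 : 5 * (l + 2) ≤ V := Nat.le_self_pow (by omega) _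
  have hF1 : F < 2 ^ (5 * (l + 1)) := by
    rw [hF, mul_comm, pow_mul]
    exact Nat.pow_lt_pow_left hjl (by norm_num)
  have hFV : F + 1 ≤ 2 ^ V := (Nat.succ_le_of_lt hF1).trans (Nat.pow_le_pow_right (by norm_num)
    (by omega))
  have hSV : S + 1 ≤ V := by
    have h1 : Nat.log 2 F < 5 * (l + 1) := by
      rcases Nat.eq_zero_or_pos F with h0 | h0
      · rw [h0]
        simp
      · exact Nat.log_lt_of_lt_pow h0.ne' hF1
    have h2 : S ≤ (5 * (l + 2)) ^ e := by
      rw [hS]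
      exact Nat.pow_le_pow_left (by omega) e
    have h3 : 1 ≤ (5 * (l + 2)) ^ e := Nat.one_le_pow _ _ (by omega)
    rw [hV, pow_succ]
    nlinarith
  have hlt : ∀ x : ℕ, x ≤ 2 ^ x := fun x => Nat.lt_two_pow_self.le
  have hj2 : j + 2 ≤ 2 ^ V :=
    (Nat.succ_le_of_lt hjl).trans (Nat.pow_le_pow_right (by norm_num) (by omega))
  have hb : b ^ (S + 1) ≤ 2 ^ (b * V) := by
    calc b ^ (S + 1) ≤ (2 ^ b) ^ (S + 1) := Nat.pow_le_pow_left (hlt b) _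
      _ = 2 ^ (b * (S + 1)) := (pow_mul _ _ _).symm
      _ ≤ 2 ^ (b * V) := Nat.pow_le_pow_right (by norm_num) (Nat.mul_le_mul_left _ hSV)
  have hKV : K ≤ 2 ^ (a + (V + (V + (V + b * V)))) := by
    have h2 : 2 ^ (a + (V + (V + (V + b * V)))) =
        2 ^ a * (2 ^ V * (2 ^ V * (2 ^ V * 2 ^ (b * V)))) := by simp only [pow_add]
    rw [hK, h2]
    exact Nat.mul_le_mul (hlt a) (Nat.mul_le_mul hFV (Nat.mul_le_mul hFV
      (Nat.mul_le_mul (hSV.trans (hlt V)) hb)))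
  calc 2 * ((F + 1) * ((F + 1) * (K * (K * s)))) * (j + 2)
      ≤ 2 ^ 1 * (2 ^ V * (2 ^ V * (2 ^ (a + (V + (V + (V + b * V)))) *
        (2 ^ (a + (V + (V + (V + b * V)))) * 2 ^ s)))) * 2 ^ V := by
        gcongr
        · norm_num
        · exact hlt s
    _ = 2 ^ (1 + (V + (V + ((a + (V + (V + (V + b * V)))) +
        ((a + (V + (V + (V + b * V)))) + s)))) + V) := by
        simp only [pow_add]
    _ ≤ 2 ^ scale j := by
        refine Nat.pow_le_pow_right (by norm_num) (le_trans ?_ hj)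
        -- The exponent is `1 + 9 * V + 2 * a + 2 * b * V + s`, at most the multiple of `V` in `hj`.
        have : 1 ≤ V := by omega
        nlinarith [Nat.mul_le_mul_left a this, Nat.mul_le_mul_left s this]
    _ ≤ s ^ scale j := Nat.pow_le_pow_left hs _

end Growth

/-! ### The block sequence and its two compression ratios. -/

section Blocks

variable {A : Type}

open Classical in
theorem card_filter_shortOutput_or_reverse [Fintype A] (hA : 2 ≤ Fintype.card A) {M : OnlineTM A}
    {T : List A → List A} (hT : M.Computes T) (hinj : Function.Injective T) {F S : ℕ}
    (hS : ∀ w : List A, w.length ≤ F → ∀ s,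
      StateTransition.Reaches (M.step w) M.init s → s.head ≤ S)
    (r m : ℕ) (X : Finset (List A)) (hX : ∀ y ∈ X, y.length = m) :
    (X.filter fun y => ∃ n ≤ F, M.ShortOutput r n y ∨ M.ShortOutput r n y.reverse).card ≤
      2 * ((F + 1) * ((F + 1) * (Fintype.card (M.ConfigCode F S) *
        (Fintype.card (M.ConfigCode F S) * Fintype.card A ^ (r + 1))))) := by
  have h1 := OnlineTM.card_filter_shortOutput hA hT hinj hS r m X hX
  have h2 := OnlineTM.card_filter_shortOutput hA hT hinj hS r m (X.image List.reverse) (by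
    intro y hy
    obtain ⟨z, hz, rfl⟩ := Finset.mem_image.1 hy
    rw [List.length_reverse, hX z hz])
  have h3 : (X.filter fun y => ∃ n ≤ F, M.ShortOutput r n y.reverse).card ≤
      ((X.image List.reverse).filter fun y => ∃ n ≤ F, M.ShortOutput r n y).card := by
    refine Finset.card_le_card_of_injOn List.reverse ?_ List.reverse_injective.injOn
    intro y hy
    obtain ⟨hy, hs⟩ := Finset.mem_filter.1 hy
    exact Finset.mem_filter.2 ⟨Finset.mem_image_of_mem _ hy, hs⟩
  have h4 : (X.filter fun y => ∃ n ≤ F, M.ShortOutput r n y ∨ M.ShortOutput r n y.reverse) =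
      (X.filter fun y => ∃ n ≤ F, M.ShortOutput r n y) ∪
        X.filter fun y => ∃ n ≤ F, M.ShortOutput r n y.reverse := by
    rw [← Finset.filter_or]
    refine Finset.filter_congr fun y _ => ?_
    constructor
    · rintro ⟨n, hn, h | h⟩
      · exact Or.inl ⟨n, hn, h⟩
      · exact Or.inr ⟨n, hn, h⟩
    · rintro (⟨n, hn, h⟩ | ⟨n, hn, h⟩)
      · exact ⟨n, hn, Or.inl h⟩
      · exact ⟨n, hn, Or.inr h⟩
  rw [h4]
  refine (Finset.card_union_le _ _).trans ?_
  omega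

/-- There are framed words that no injective machine with polylogarithmic space can shorten
by much. -/
theorem exists_hard_blocks [Fintype A] (hA : 2 ≤ Fintype.card A) (a₀ : A) {k : ℕ} (hk : 1 ≤ k) :
    ∃ x : ℕ → List A, (∀ j, x j ∈ framedWords a₀ k (scale j)) ∧
      ∀ (M : OnlineTM A) (T : List A → List A), M.Computes T → M.PolylogSpace →
        Function.Injective T → ∀ᶠ j in atTop, ∀ n ≤ (j + 1) ^ 5,
          ¬ M.ShortOutput ((k - 1) * scale j) n (x j) ∧
          ¬ M.ShortOutput ((k - 1) * scale j) n (x j).reverse := by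
  classical
  obtain ⟨x, hx, hx'⟩ := exists_forall_eventually_not
    (ι := {M : OnlineTM A // ∃ T, M.Computes T ∧ M.PolylogSpace ∧ Function.Injective T})
    (fun j => framedWords a₀ k (scale j))
    (fun j => by
      rw [← Finset.card_pos, card_framedWords]
      exact Nat.pow_pos (by omega))
    (fun M j y => ∃ n ≤ (j + 1) ^ 5, M.1.ShortOutput ((k - 1) * scale j) n y ∨
      M.1.ShortOutput ((k - 1) * scale j) n y.reverse)
    (by
      rintro ⟨M, T, hT, ⟨e, he⟩, hinj⟩
      filter_upwards [eventually_count M.numStates M.numSymbols e (Fintype.card A) hA] with j hj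
      have h1 := hj _ _ _ rfl rfl (OnlineTM.card_configCode M _ _)
      have h2 := card_filter_shortOutput_or_reverse hA hT hinj (F := (j + 1) ^ 5)
        (S := (Nat.log 2 ((j + 1) ^ 5) + 2) ^ e) (fun w hw s hs => (he w s hs).le.trans
          (Nat.pow_le_pow_left (Nat.add_le_add_right (Nat.log_mono_right hw) 2) e))
        ((k - 1) * scale j) _ _ (fun y hy => length_of_mem_framedWords (a₀ := a₀) (k := k)
          (g := scale j) hy)
      rw [card_framedWords]
      refine le_trans (le_of_eq (by congr!)) ((Nat.mul_le_mul_right (j + 2) h2).trans ?_)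
      -- Of the exponent `k * scale j`, the part `(k - 1) * scale j` pays for the outputs and the
      -- remaining `scale j` for everything else.
      calc _ = _ := ?_
        _ ≤ _ := Nat.mul_le_mul_right (Fintype.card A ^ ((k - 1) * scale j)) h1
        _ = _ := ?_
      · rw [pow_succ]
        ring
      · rw [← pow_add]
        congr 1
        obtain ⟨k, rfl⟩ := Nat.exists_eq_add_of_le' hk
        rw [Nat.add_sub_cancel]
        ring)
  refine ⟨x, hx, fun M T hT hM hinj => ?_⟩
  filter_upwards [hx' ⟨M, T, hT, hM, hinj⟩] with j hj n hn
  exact ⟨fun h => hj ⟨n, hn, Or.inl h⟩, fun h => hj ⟨n, hn, Or.inr h⟩⟩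

/-- Concatenation of the first `j` of the blocks `x i`, `a`, reversal of `x i`. -/
def blockPrefix (a : A) (x : ℕ → List A) : ℕ → List A
  | 0 => []
  | j + 1 => blockPrefix a x j ++ (x j ++ a :: (x j).reverse)

theorem length_blockPrefix (a : A) {x : ℕ → List A} {k : ℕ}
    (hx : ∀ j, (x j).length = k * scale j) (J : ℕ) :
    (blockPrefix a x J).length = 2 * k * ∑ j ∈ Finset.range J, scale j + J := by
  induction J with
  | zero => simp [blockPrefix]
  | succ J ih =>
    rw [blockPrefix, List.length_append, ih, Finset.sum_range_succ]
    simp [hx]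
    ring

theorem strictMono_length_blockPrefix (a : A) (x : ℕ → List A) :
    StrictMono fun j => (blockPrefix a x j).length := by
  refine strictMono_nat_of_lt_succ fun j => ?_
  simp only [blockPrefix, List.length_append, List.length_cons]
  omega

/-- Here `n` is at most `2 * k + 1` times the fourth power of `√J + 1`, and the fifth power absorbs
the constant. Hence blocks are hard for input length `n` already from index `√J` on. -/
theorem le_sqrt_pow_of_lt_length_blockPrefix (a : A) {x : ℕ → List A} {k : ℕ}
    (hx : ∀ j, (x j).length = k * scale j) {J n : ℕ} (hJ : 2 * k + 2 ≤ Nat.sqrt J)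
    (hn : n < (blockPrefix a x (J + 1)).length) : n ≤ (Nat.sqrt J + 1) ^ 5 := by
  rw [length_blockPrefix a hx] at hn
  have h1 := sum_scale_le_sq (J + 1)
  have h2 : J + 1 ≤ (Nat.sqrt J + 1) ^ 2 := by
    have := Nat.lt_succ_sqrt J
    rw [Nat.succ_eq_add_one] at this
    nlinarith
  set q := Nat.sqrt J
  have h3 : (J + 1) ^ 2 ≤ (q + 1) ^ 4 := by
    calc (J + 1) ^ 2 ≤ ((q + 1) ^ 2) ^ 2 := Nat.pow_le_pow_left h2 2
      _ = (q + 1) ^ 4 := by ring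
  calc n ≤ 2 * k * (q + 1) ^ 4 + (q + 1) ^ 4 := by nlinarith
    _ = (2 * k + 1) * (q + 1) ^ 4 := by ring
    _ ≤ (q + 1) * (q + 1) ^ 4 := Nat.mul_le_mul_right _ (by omega)
    _ = (q + 1) ^ 5 := by ring

theorem eventually_le_ratio_plogon [Fintype A] (a : A) {x : ℕ → List A} {k : ℕ} {ε : ℝ}
    (hkε : 4 ≤ (k + 1) * ε) (hk : 1 ≤ k)
    (hx : ∀ j, (x j).length = (k + 1) * scale j) {S : ℕ → A}
    (hS : ∀ j, seqPrefix S (blockPrefix a x j).length = blockPrefix a x j)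
    {M : OnlineTM A} {T : List A → List A} (hT : M.Computes T)
    (hM : ∀ᶠ j in atTop, ∀ n ≤ (j + 1) ^ 5,
          ¬ M.ShortOutput ((k - 1) * scale j) n (x j) ∧
          ¬ M.ShortOutput ((k - 1) * scale j) n (x j).reverse) :
    ∀ᶠ n : ℕ in atTop, 1 - ε ≤ ((T (seqPrefix S n)).length : ℝ) / n := by
  obtain ⟨j₀, hj₀⟩ := eventually_atTop.1 hM
  refine eventually_of_blocks (strictMono_length_blockPrefix a x) ?_
  -- The square yields `√J ≥ j₀` and the hypothesis of the bound on `n`; the linear threshold serves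
  -- the final comparison. Blocks before `√J` are given up, at a cost of `G₁ ≤ J`.
  filter_upwards [eventually_ge_atTop ((j₀ + 2 * k + 4) ^ 2), eventually_ge_atTop (8 * k + 10)]
    with J hJ hJ' n hn hn'
  have hq : j₀ + 2 * k + 4 ≤ Nat.sqrt J := Nat.le_sqrt'.2 hJ
  have hnq := le_sqrt_pow_of_lt_length_blockPrefix a hx (by omega) hn'
  have hqJ : Nat.sqrt J ≤ J := Nat.sqrt_le_self J
  have key := OnlineTM.le_length_of_blocks hT (W := blockPrefix a x) (x := x) (a := a)
    (fun _ => rfl) (r := fun j => (k - 1) * scale j) (w := seqPrefix S n) hqJ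
    (hS J ▸ seqPrefix_isPrefix S hn) (fun j hj _ => by
      rw [length_seqPrefix]
      exact hj₀ j (by omega) n (hnq.trans (Nat.pow_le_pow_left (by omega) 5)))
  rw [length_blockPrefix a hx, Finset.sum_range_succ] at hn'
  have hg := scale_le J
  have hG := sq_le_four_mul_sum_scale J
  have hG1 := (sum_scale_le_sq (Nat.sqrt J)).trans (Nat.sqrt_le' J)
  have hsplit := Finset.sum_range_add_sum_Ico (fun j => scale j) hqJ
  have hsum : ∑ j ∈ Finset.Ico (Nat.sqrt J) J, 2 * ((k - 1) * scale j) =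
      2 * (k - 1) * ∑ j ∈ Finset.Ico (Nat.sqrt J) J, scale j := by
    rw [Finset.mul_sum]
    exact Finset.sum_congr rfl fun j _ => by ring
  rw [hsum] at key
  set G := ∑ j ∈ Finset.range J, scale j
  set G₁ := ∑ j ∈ Finset.range (Nat.sqrt J), scale j
  set G₂ := ∑ j ∈ Finset.Ico (Nat.sqrt J) J, scale j
  have hn0 : 0 < n := by
    rw [length_blockPrefix a hx] at hn
    omega
  rw [le_div_iff₀ (by exact_mod_cast hn0)]
  rcases le_total (1 - ε) 0 with hε | hε
  · exact (mul_nonpos_of_nonpos_of_nonneg hε (Nat.cast_nonneg n)).trans (Nat.cast_nonneg _)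
  have hn2 : (n : ℝ) ≤ 2 * (k + 1) * (G + (J + 1)) + (J + 1) := by
    have : n ≤ 2 * (k + 1) * (G + (J + 1)) + (J + 1) := by
      refine hn'.le.trans ?_
      gcongr
    exact_mod_cast this
  have hk2 : ((k - 1 : ℕ) : ℝ) = k - 1 := by simp [Nat.cast_sub hk]
  have key' : 2 * ((k : ℝ) - 1) * G₂ ≤ ((T (seqPrefix S n)).length : ℝ) := by
    rw [← hk2]
    exact_mod_cast key
  refine le_trans ?_ key'
  have hG' : (J : ℝ) ^ 2 ≤ 4 * G := by exact_mod_cast hG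
  have hG1' : (G₁ : ℝ) ≤ J := by exact_mod_cast hG1
  have hs' : (G₁ : ℝ) + G₂ = G := by exact_mod_cast hsplit
  have hJ1 : 8 * (k : ℝ) + 10 ≤ J := by exact_mod_cast hJ'
  have hk1 : (1 : ℝ) ≤ k := by exact_mod_cast hk
  have hG0 : (0 : ℝ) ≤ G := Nat.cast_nonneg G
  have hε0 : 0 ≤ ε := by
    by_contra h
    nlinarith
  calc (1 - ε) * n ≤ (1 - ε) * (2 * (k + 1) * (G + (J + 1)) + (J + 1)) :=
        mul_le_mul_of_nonneg_left hn2 hε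
    _ = 2 * ((k + 1) - (k + 1) * ε) * G + (1 - ε) * ((2 * k + 3) * (J + 1)) := by ring
    _ ≤ 2 * ((k + 1) - 4) * G + 1 * ((2 * k + 3) * (J + 1)) := by
        gcongr
        linarith
    -- Two symbols per frame are lost but `hkε` allows for four; the surplus `4 * G ≥ J ^ 2` absorbs
    -- all terms linear in `J`.
    _ ≤ 2 * ((k : ℝ) - 1) * (G - J) := by
        nlinarith [mul_le_mul_of_nonneg_right hJ1 (show (0 : ℝ) ≤ J by linarith)]
    _ ≤ 2 * ((k : ℝ) - 1) * G₂ := by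
        apply mul_le_mul_of_nonneg_left <;> linarith

theorem eventually_ratio_palOutput_le {a₀ a₁ : A} {x : ℕ → List A} {k : ℕ}
    (hk : 2 ≤ k) (hx : ∀ j, (x j).length = k * scale j)
    (hx' : ∀ j i, (x j)[k * i]? ≠ some a₁) {S : ℕ → A}
    (hS : ∀ j, seqPrefix S (blockPrefix a₁ x j).length = blockPrefix a₁ x j)
    {δ : ℝ} (hδ : 0 < δ) :
    ∃ L N : ℕ, ∀ᶠ n : ℕ in atTop,
      ((PushdownTransducer.palOutput L N a₀ a₁ (seqPrefix S n)).length : ℝ) / n ≤ 1 / 2 + δ := by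
  -- Each frame of length `k * 2 ^ ρ` costs one additional symbol, at most `δ` times its length.
  obtain ⟨ρ, hρ⟩ := pow_unbounded_of_one_lt (1 / δ) (show (1 : ℝ) < 2 by norm_num)
  have hL2 : 2 ≤ k * 2 ^ ρ := hk.trans (Nat.le_mul_of_pos_right _ (by positivity))
  have hj₀ : 1 ≤ (blockPrefix a₁ x (2 ^ ρ)).length :=
    Nat.one_le_two_pow.trans ((strictMono_length_blockPrefix a₁ x).id_le _)
  refine ⟨k * 2 ^ ρ, (blockPrefix a₁ x (2 ^ ρ)).length - 1, ?_⟩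
  have key := PushdownTransducer.length_palOutput (a₀ := a₀) hL2 (blockPrefix a₁ x) x
    (fun _ => rfl)
    (fun j => 2 ^ (Nat.log 2 (j + 1) - ρ)) (2 ^ ρ) (Nat.sub_add_cancel hj₀).symm
    (fun j hj => by
      have : ρ ≤ Nat.log 2 (j + 1) := Nat.le_log_of_pow_le (by norm_num) (by omega)
      rw [hx, scale, mul_assoc, ← pow_add, Nat.add_sub_cancel' this])
    (fun j _ i => by
      rw [mul_assoc]
      exact hx' j _)
  have hterm : ∀ j ≥ 2 ^ ρ, ((k * 2 ^ ρ * 2 ^ (Nat.log 2 (j + 1) - ρ) + 1 +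
      2 ^ (Nat.log 2 (j + 1) - ρ) : ℕ) : ℝ) ≤ (1 + δ) * k * scale j + 1 := by
    intro j hj
    have h1 : ρ ≤ Nat.log 2 (j + 1) := Nat.le_log_of_pow_le (by norm_num) (by omega)
    have h2 : scale j = 2 ^ ρ * 2 ^ (Nat.log 2 (j + 1) - ρ) := by
      rw [scale, ← pow_add, Nat.add_sub_cancel' h1]
    rw [h2]
    push_cast
    have hc : (0 : ℝ) ≤ 2 ^ (Nat.log 2 (j + 1) - ρ) := by positivity
    have hk1 : (1 : ℝ) ≤ k := by exact_mod_cast (by omega : 1 ≤ k)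
    have h3 : 1 ≤ 2 ^ ρ * δ := ((div_lt_iff₀ hδ).1 hρ).le
    have h4 : 1 ≤ k * (2 ^ ρ * δ) := one_le_mul_of_one_le_of_one_le hk1 h3
    nlinarith [mul_le_mul_of_nonneg_right h4 hc]
  set N₀ := (blockPrefix a₁ x (2 ^ ρ)).length
  refine eventually_of_blocks (strictMono_length_blockPrefix a₁ x) ?_
  -- Beyond `J₀` the startup cost `N₀` and all terms linear in `J` are at most `δ * k * G`, because
  -- `4 * G ≥ J ^ 2`.
  obtain ⟨J₀, hJ₀⟩ := exists_nat_gt ((N₀ + 2 * ((1 + δ) * k + 1)) / (δ * k / 4))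
  filter_upwards [eventually_ge_atTop J₀, eventually_ge_atTop (2 ^ ρ + 1)] with J hJ hJ' n hn hn'
  have h1 : ((PushdownTransducer.palOutput (k * 2 ^ ρ) (N₀ - 1) a₀ a₁ (seqPrefix S n)).length : ℝ) ≤
      N₀ + ((1 + δ) * k * (∑ j ∈ Finset.range J, scale j + (J + 1) : ℕ) + (J + 1)) := by
    have h2 : (PushdownTransducer.palOutput (k * 2 ^ ρ) (N₀ - 1) a₀ a₁ (seqPrefix S n)).length ≤
        N₀ + ∑ j ∈ Finset.Ico (2 ^ ρ) (J + 1), (k * 2 ^ ρ * 2 ^ (Nat.log 2 (j + 1) - ρ) + 1 +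
          2 ^ (Nat.log 2 (j + 1) - ρ)) := by
      rw [← key (J + 1) (by omega)]
      refine (PushdownTransducer.palOutput_isPrefix _ _ _ _ ?_).length_le
      rw [← hS]
      exact seqPrefix_isPrefix S hn'.le
    refine (Nat.cast_le.2 h2).trans ?_
    rw [Nat.cast_add, Nat.cast_sum]
    gcongr
    calc _ ≤ ∑ j ∈ Finset.Ico (2 ^ ρ) (J + 1), ((1 + δ) * k * scale j + 1) :=
          Finset.sum_le_sum fun j hj => hterm j (Finset.mem_Ico.1 hj).1
      _ ≤ ∑ j ∈ Finset.range (J + 1), ((1 + δ) * k * scale j + 1) :=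
          Finset.sum_le_sum_of_subset_of_nonneg
            (fun j hj => Finset.mem_range.2 (Finset.mem_Ico.1 hj).2)
            fun j _ _ => by positivity
      _ = (1 + δ) * k * (∑ j ∈ Finset.range (J + 1), scale j : ℕ) + (J + 1) := by
          rw [Finset.sum_add_distrib, ← Finset.mul_sum]
          simp
      _ ≤ _ := by
          rw [Finset.sum_range_succ]
          have := scale_le J
          gcongr
  have hn1 : (2 * k * ∑ j ∈ Finset.range J, scale j + J : ℕ) ≤ (n : ℝ) := by
    rw [← length_blockPrefix a₁ hx]
    exact_mod_cast hn
  have hn0 : (0 : ℝ) < n := by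
    refine lt_of_lt_of_le ?_ hn1
    exact_mod_cast Nat.add_pos_right _ (lt_of_lt_of_le (Nat.succ_pos _) hJ')
  rw [div_le_iff₀ hn0]
  refine h1.trans ?_
  have hG := sq_le_four_mul_sum_scale J
  generalize ∑ j ∈ Finset.range J, scale j = G at *
  have hG' : (J : ℝ) ^ 2 ≤ 4 * G := by exact_mod_cast hG
  push_cast at hn1 ⊢
  have hk0 : (0 : ℝ) < k := by exact_mod_cast (by omega : 0 < k)
  have hδk : 0 < δ * k := mul_pos hδ hk0
  have hJ1 : (1 : ℝ) ≤ J := by exact_mod_cast (Nat.succ_pos _).trans_le hJ'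
  have hJ2 : N₀ + 2 * ((1 + δ) * k + 1) ≤ J * (δ * k / 4) :=
    ((div_lt_iff₀ (by positivity)).1 (hJ₀.trans_le (Nat.cast_le.2 hJ))).le
  have hJ3 : N₀ + ((1 + δ) * k + 1) * (J + 1) ≤ (N₀ + 2 * ((1 + δ) * k + 1)) * J := by
    have h2 : 0 ≤ (N₀ : ℝ) * (J - 1) := mul_nonneg (Nat.cast_nonneg _) (by linarith)
    have h3 : 0 ≤ ((1 + δ) * k + 1) * ((J : ℝ) - 1) := mul_nonneg (by positivity) (by linarith)
    linarith
  have hJ4 : (N₀ + 2 * ((1 + δ) * k + 1)) * J ≤ δ * k * G := by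
    have h2 := mul_le_mul_of_nonneg_right hJ2 (show (0 : ℝ) ≤ J by linarith)
    have h3 := mul_le_mul_of_nonneg_left hG' hδk.le
    linarith
  have hn2 : (1 / 2 + δ) * (2 * k * G + J) ≤ (1 / 2 + δ) * n :=
    mul_le_mul_of_nonneg_left hn1 (by positivity)
  have hδJ : 0 ≤ δ * J := by positivity
  linarith

end Blocks

/-! ### Conclusion. -/

theorem theorem3 {A : Type} [Fintype A] (hA : 2 ≤ Fintype.card A) (ε : ℝ) (hε : 0 < ε) :
    ∃ S : ℕ → A, RInvPD S ≤ ((1 / 2 : ℝ) : EReal) ∧ ((1 - ε : ℝ) : EReal) ≤ rhoPlogon S := by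
  obtain ⟨a₀, a₁, h01⟩ := Fintype.exists_pair_of_one_lt_card hA
  obtain ⟨k, hk⟩ := exists_nat_gt (4 / ε)
  obtain ⟨x, hx, hM⟩ := exists_hard_blocks hA a₀ (k := k + 1) (by omega)
  have hxl : ∀ j, (x j).length = (k + 1 + 1) * scale j := fun j => length_of_mem_framedWords (hx j)
  have hxf : ∀ j i, (x j)[(k + 1 + 1) * i]? ≠ some a₁ :=
    fun j => getElem?_ne_of_mem_framedWords h01 (hx j)
  have : Nonempty A := ⟨a₀⟩
  obtain ⟨S, hS⟩ := exists_seqPrefix_eq (blockPrefix a₁ x) (fun j => List.prefix_append _ _)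
    (strictMono_length_blockPrefix a₁ x).id_le
  refine ⟨S, ?_, ?_⟩
  -- Each `z > 1 / 2` has its own `L` and `N`, while `S` stays fixed; the value one half is obtained
  -- through the infimum over compressors.
  · refine EReal.le_of_forall_lt_iff_le.1 fun z hz => ?_
    obtain ⟨L, N, h⟩ := eventually_ratio_palOutput_le (a₀ := a₀) (by omega) hxl hxf hS
      (δ := z - 1 / 2) (by linarith [EReal.coe_lt_coe_iff.1 hz])
    refine iInf₂_le_of_le _ (PushdownTransducer.isInvPD_palOutput L N h01) ?_
    refine limsup_le_of_le (by isBoundedDefault) ?_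
    filter_upwards [h] with n hn
    rw [add_sub_cancel] at hn
    exact EReal.coe_le_coe_iff.2 hn
  · refine le_iInf₂ fun T hT => ?_
    obtain ⟨⟨M, hMT, hMS⟩, hinj⟩ := hT
    have hkε : 4 ≤ (((k + 1 : ℕ) : ℝ) + 1) * ε := by
      rw [div_lt_iff₀ hε] at hk
      push_cast
      nlinarith
    refine le_liminf_of_le (by isBoundedDefault) ?_
    filter_upwards [eventually_le_ratio_plogon a₁ hkε (by omega) hxl hS hMT
      (hM M T hMT hMS hinj)] with n hn
    exact EReal.coe_le_coe_iff.2 hn
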